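/- Let $R$ and $S$ be associative rings with identity and let ${}_RC_S$ be a semidualizing bimodule, that is: ${}_RC$ and $C_S$ have resolutions by finitely generated projective modules, the homothety maps $R\to\operatorname{Hom}_{S^{op}}(C,C)$ and $S\to\operatorname{Hom}_R(C,C)$ are isomorphisms, and $\operatorname{Ext}_R^{i}(C,C)=0=\operatorname{Ext}_{S^{op}}^{i}(C,C)$ for all $i\ge 1$. Let $\mathcal{A}_C(S)$ be the Auslander class, i.e. the class of left $S$-modules $N$ such that $\operatorname{Tor}^S_{i}(C,N)=0$ and $\operatorname{Ext}_R^{i}(C,C\otimes_SN)=0$ for all $i\geq 1$, and the canonical map $N\to\operatorname{Hom}_R(C,C\otimes_SN)$, $x\mapsto(c\mapsto c\otimes x)$, is an isomorphism. Let $\mathcal{I}_C(S)$ be the class of left $S$-modules isomorphic to $\operatorname{Hom}_R(C,I)$ for some injective left $R$-module $I$. For a class $\mathcal{X}$ of left $S$-modules, $\mathcal{X}\text{-}\mathrm{pd}\,N$ is the infimum of all $n\ge 0$ for which there is an exact sequence $0\to X_n\to\cdots\to X_0\to N\to 0$ with all $X_i\in\mathcal{X}$ ($\infty$ if there is none); by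 convention, $\mathcal{X}\text{-}\mathrm{pd}\,N\le -1$ means $N=0$. Let $N$ be a left $S$-module with $\mathcal{A}_C(S)\text{-}\mathrm{pd}\,N<\infty$ and let $n\ge 0$. Then the following statements are equivalent. 1. $\mathcal{A}_C(S)\text{-}\mathrm{pd}\,N\le n$. 2. $\Omega^n(N)\in\mathcal{A}_C(S)$ for some $n$-th syzygy $\Omega^n(N)$ of $N$ (formed with projective modules, $\Omega^0(N)=N$); equivalently, for every $n$-th syzygy of $N$. 3. $\operatorname{Tor}^S_{i}(C,N)=0$ for all $i\ge n+1$. 4. There is an exact sequence $0\to H\to A\to N\to 0$ of left $S$-modules with $A\in\mathcal{A}_C(S)$ and $\mathcal{I}_C(S)\text{-}\mathrm{pd}\,H\le n-1$. 5. There is an exact sequence $0\to N\to H'\to A'\to 0$ of left $S$-modules with $A'\in\mathcal{A}_C(S)$ and $\mathcal{I}_C(S)\text{-}\mathrm{pd}\,H'\le n$. 6. There is a sequence as in 5 which moreover stays exact under $\operatorname{Hom}_S(-,U)$ for every $U\in\mathcal{I}_C(S)$. -/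

import Mathlib

open CategoryTheory MulOpposite
open scoped TensorProduct

universe u

namespace AuslanderClass

section Tensor

/- An `(R, S)`-bimodule `C` is an abelian group that is a left `R`-module and a right `S`-module
(a module over `Sᵐᵒᵖ`), the two actions commuting. The product `c * s` is written `op s • c`. -/
variable (R S C : Type u) [Ring R] [Ring S] [AddCommGroup C] [Module R C] [Module Sᵐᵒᵖ C]
  [SMulCommClass R Sᵐᵒᵖ C]
variable (N : Type u) [AddCommGroup N] [Module S N]

/-- The elements `(c * s) ⊗ x - c ⊗ (s * x)` of `C ⊗_ℤ N`. -/
def balancedRel : Set (C ⊗[ℤ] N) :=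
  {z | ∃ (c : C) (s : S) (x : N), z = (op s • c) ⊗ₜ[ℤ] x - c ⊗ₜ[ℤ] (s • x)}

/-- The additive subgroup of `C ⊗_ℤ N` generated by the elements `(c * s) ⊗ x - c ⊗ (s * x)`;
it is stable under the action of `R` on `C`. -/
def balancedSubmodule : Submodule R (C ⊗[ℤ] N) :=
  { AddSubgroup.closure (balancedRel S C N) with
    smul_mem' := by
      intro r z hz
      change z ∈ AddSubgroup.closure (balancedRel S C N) at hz
      change r • z ∈ AddSubgroup.closure (balancedRel S C N)
      induction hz using AddSubgroup.closure_induction with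
      | mem z hz =>
        obtain ⟨c, s, x, rfl⟩ := hz
        refine AddSubgroup.subset_closure ⟨r • c, s, x, ?_⟩
        rw [smul_sub, TensorProduct.smul_tmul', TensorProduct.smul_tmul', smul_comm r (op s) c]
      | zero => rw [smul_zero]; exact zero_mem _
      | add a b _ _ ha hb => rw [smul_add]; exact add_mem ha hb
      | neg a _ ha => rw [smul_neg]; exact neg_mem ha }

/-- The tensor product `C ⊗_S N` over the (possibly noncommutative) ring `S`. -/
def BTensor : Type u := (C ⊗[ℤ] N) ⧸ balancedSubmodule R S C N

instance : AddCommGroup (BTensor R S C N) :=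
  inferInstanceAs (AddCommGroup ((C ⊗[ℤ] N) ⧸ balancedSubmodule R S C N))

/-- `C ⊗_S N` is a left `R`-module through the left action of `R` on `C`. -/
instance : Module R (BTensor R S C N) :=
  inferInstanceAs (Module R ((C ⊗[ℤ] N) ⧸ balancedSubmodule R S C N))

variable {N}

/-- The element `c ⊗ x` of `C ⊗_S N`. -/
def btmul (c : C) (x : N) : BTensor R S C N :=
  (balancedSubmodule R S C N).mkQ (c ⊗ₜ[ℤ] x)

variable {S C} in
lemma btmul_smul (c : C) (s : S) (x : N) :
    btmul R S C (op s • c) x = btmul R S C c (s • x) :=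
  (Submodule.Quotient.eq _).2 (AddSubgroup.subset_closure ⟨c, s, x, rfl⟩)

variable {R S C} in
lemma BTensor.hom_ext {M : Type*} [AddCommGroup M] [Module R M]
    {f g : BTensor R S C N →ₗ[R] M} (h : ∀ c x, f (btmul R S C c x) = g (btmul R S C c x)) :
    f = g := by
  refine Submodule.linearMap_qext (balancedSubmodule R S C N) (LinearMap.ext fun z => ?_)
  induction z using TensorProduct.induction_on with
  | zero => rw [map_zero, map_zero]
  | tmul c x => exact h c x
  | add a b ha hb => rw [map_add, map_add, ha, hb]

/-- The map `C ⊗_S f : C ⊗_S N → C ⊗_S N'`, `c ⊗ x ↦ c ⊗ f x`. -/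
def BTensor.map {N' : Type u} [AddCommGroup N'] [Module S N'] (f : N →ₗ[S] N') :
    BTensor R S C N →ₗ[R] BTensor R S C N' :=
  Submodule.mapQ (balancedSubmodule R S C N) (balancedSubmodule R S C N')
    (TensorProduct.AlgebraTensorModule.lTensor R C f.toAddMonoidHom.toIntLinearMap) (by
      intro z hz
      change z ∈ AddSubgroup.closure (balancedRel S C N) at hz
      rw [Submodule.mem_comap]
      induction hz using AddSubgroup.closure_induction with
      | mem z hz =>
        obtain ⟨c, s, x, rfl⟩ := hz
        exact AddSubgroup.subset_closure ⟨c, s, f x, by simp⟩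
      | zero => rw [map_zero]; exact zero_mem _
      | add a b _ _ ha hb => rw [map_add]; exact add_mem ha hb
      | neg a _ ha => rw [map_neg]; exact neg_mem ha)

@[simp]
lemma BTensor.map_btmul {N' : Type u} [AddCommGroup N'] [Module S N'] (f : N →ₗ[S] N')
    (c : C) (x : N) : BTensor.map R S C f (btmul R S C c x) = btmul R S C c (f x) := rfl

lemma btmul_add (c : C) (x y : N) :
    btmul R S C c (x + y) = btmul R S C c x + btmul R S C c y :=
  (congrArg (balancedSubmodule R S C N).mkQ (TensorProduct.tmul_add c x y)).trans
    (map_add (balancedSubmodule R S C N).mkQ _ _)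

lemma add_btmul (c d : C) (x : N) :
    btmul R S C (c + d) x = btmul R S C c x + btmul R S C d x :=
  (congrArg (balancedSubmodule R S C N).mkQ (TensorProduct.add_tmul c d x)).trans
    (map_add (balancedSubmodule R S C N).mkQ _ _)

lemma smul_btmul (r : R) (c : C) (x : N) :
    btmul R S C (r • c) x = r • btmul R S C c x := rfl

/-- The functor `C ⊗_S - : Mod S ⥤ Mod R`. -/
def tensorFunctor : ModuleCat.{u} S ⥤ ModuleCat.{u} R where
  obj N := ModuleCat.of R (BTensor R S C N)
  map f := ModuleCat.ofHom (BTensor.map R S C f.hom)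
  map_id _ := ModuleCat.hom_ext (BTensor.hom_ext fun _ _ => rfl)
  map_comp _ _ := ModuleCat.hom_ext (BTensor.hom_ext fun _ _ => rfl)

instance : (tensorFunctor R S C).Additive where
  map_add {_ _ f g} :=
    ModuleCat.hom_ext (BTensor.hom_ext fun c x => btmul_add R S C c (f.hom x) (g.hom x))

/-- `Tor_i^S(C, N)`, the `i`-th left derived functor of `C ⊗_S -` at `N`. -/
noncomputable def TorC (i : ℕ) (N : ModuleCat.{u} S) : ModuleCat.{u} R :=
  ((tensorFunctor R S C).leftDerived i).obj N

end Tensor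

section Hom

variable (R S C : Type u) [Ring R] [Ring S] [AddCommGroup C] [Module R C] [Module Sᵐᵒᵖ C]
  [SMulCommClass R Sᵐᵒᵖ C]

/-- Left multiplication by `r` on `C`, as a homomorphism of right `S`-modules. -/
def leftMul (r : R) : C →ₗ[Sᵐᵒᵖ] C where
  toFun c := r • c
  map_add' c d := smul_add r c d
  map_smul' s c := smul_comm r s c

/-- Right multiplication by `s` on `C`, as a homomorphism of left `R`-modules. -/
def rightMul (s : S) : C →ₗ[R] C where
  toFun c := op s • c
  map_add' c d := smul_add (op s) c d
  map_smul' r c := (smul_comm r (op s) c).symm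

variable (M : Type u) [AddCommGroup M] [Module R M]

/-- The abelian group `Hom_R(C, M)`; as a type depending on `S` it carries the structure of a
left `S`-module defined below. -/
@[nolint unusedArguments]
def HomC (R _S C : Type u) [Ring R] [AddCommGroup C] [Module R C]
    (M : Type u) [AddCommGroup M] [Module R M] : Type u := C →ₗ[R] M

instance : AddCommGroup (HomC R S C M) := inferInstanceAs (AddCommGroup (C →ₗ[R] M))

variable {R S C M}

/-- An element of `Hom_R(C, M)` as a linear map. -/
def HomC.toLin (f : HomC R S C M) : C →ₗ[R] M := f

/-- A linear map as an element of `Hom_R(C, M)`. -/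
def HomC.ofLin (f : C →ₗ[R] M) : HomC R S C M := f

lemma HomC.ext {f g : HomC R S C M} (h : ∀ c, f.toLin c = g.toLin c) : f = g :=
  LinearMap.ext h

/-- `Hom_R(C, M)` is a left `S`-module by `(s * f) c = f (c * s)`. -/
instance : Module S (HomC R S C M) where
  smul s f := HomC.ofLin (f.toLin ∘ₗ rightMul R S C s)
  one_smul f := HomC.ext fun c => congrArg f.toLin (one_smul Sᵐᵒᵖ c)
  mul_smul s t f := HomC.ext fun c => congrArg f.toLin (mul_smul (op t) (op s) c)
  smul_zero _ := rfl
  smul_add _ _ _ := rfl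
  add_smul s t f := HomC.ext fun c =>
    (congrArg f.toLin (add_smul (op s) (op t) c)).trans (map_add f.toLin _ _)
  zero_smul f := HomC.ext fun c =>
    (congrArg f.toLin (zero_smul Sᵐᵒᵖ c)).trans (map_zero f.toLin)

variable (R S C)

/-- The canonical valuation homomorphism `μ_N : N → Hom_R(C, C ⊗_S N)`, `μ_N x c = c ⊗ x`. -/
def muC (N : Type u) [AddCommGroup N] [Module S N] : N →ₗ[S] HomC R S C (BTensor R S C N) where
  toFun x := HomC.ofLin
    { toFun := fun c => btmul R S C c x
      map_add' := fun c d => add_btmul R S C c d x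
      map_smul' := fun r c => smul_btmul R S C r c x }
  map_add' x y := HomC.ext fun c => btmul_add R S C c x y
  map_smul' s x := HomC.ext fun c => (btmul_smul R c s x).symm

end Hom

section Classes

variable (R S C : Type u) [Ring R] [Ring S] [AddCommGroup C] [Module R C] [Module Sᵐᵒᵖ C]
  [SMulCommClass R Sᵐᵒᵖ C]

/-- A module has a degreewise finite projective resolution: a resolution by finitely generated
projective modules. -/
def HasDegreewiseFiniteResolution {A : Type u} [Ring A] (M : ModuleCat.{u} A) : Prop :=
  ∃ P : ProjectiveResolution M, ∀ i : ℕ, Module.Finite A (P.complex.X i)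

/-- The `(R, S)`-bimodule `C` is semidualizing. -/
structure IsSemidualizing : Prop where
  finite_left : HasDegreewiseFiniteResolution (ModuleCat.of R C)
  finite_right : HasDegreewiseFiniteResolution (ModuleCat.of Sᵐᵒᵖ C)
  /-- the homothety map `R → Hom_{Sᵒᵖ}(C, C)`, `r ↦ (c ↦ r * c)`, is an isomorphism -/
  homothety_left : Function.Bijective (leftMul R S C)
  /-- the homothety map `S → Hom_R(C, C)`, `s ↦ (c ↦ c * s)`, is an isomorphism -/
  homothety_right : Function.Bijective (rightMul R S C)
  ext_left : ∀ i : ℕ, 1 ≤ i →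
    Subsingleton (Abelian.Ext.{u} (ModuleCat.of R C) (ModuleCat.of R C) i)
  ext_right : ∀ i : ℕ, 1 ≤ i →
    Subsingleton (Abelian.Ext.{u} (ModuleCat.of Sᵐᵒᵖ C) (ModuleCat.of Sᵐᵒᵖ C) i)

/-- The Auslander class `𝒜_C(S)` in `Mod S`. -/
structure InAuslander (N : ModuleCat.{u} S) : Prop where
  tor_vanish : ∀ i : ℕ, 1 ≤ i → Subsingleton (TorC R S C i N)
  ext_vanish : ∀ i : ℕ, 1 ≤ i →
    Subsingleton (Abelian.Ext.{u} (ModuleCat.of R C) (ModuleCat.of R (BTensor R S C N)) i)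
  mu_bijective : Function.Bijective (muC R S C N)

/-- The class `ℐ_C(S)` of `C`-injective modules: those isomorphic to `Hom_R(C, I)` for some
injective left `R`-module `I`. -/
def IsCInjective (U : ModuleCat.{u} S) : Prop :=
  ∃ I : ModuleCat.{u} R, Injective I ∧ Nonempty (U ≃ₗ[S] HomC R S C I)

end Classes

section Dimension

variable {S : Type u} [Ring S]

/-- `0 → L → M → K → 0` is exact. -/
def IsShortExact {L M K : ModuleCat.{u} S} (f : L →ₗ[S] M) (g : M →ₗ[S] K) : Prop :=
  Function.Injective f ∧ Function.Exact f g ∧ Function.Surjective g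

/-- The sequence `0 → L → M → K → 0` becomes exact after applying `Hom_S(-, X)`
for every `X` in the class `𝒳`: the sequence
`0 → Hom_S(K, X) → Hom_S(M, X) → Hom_S(L, X) → 0` is exact. -/
def IsHomExact (𝒳 : ModuleCat.{u} S → Prop) {L M K : ModuleCat.{u} S}
    (f : L →ₗ[S] M) (g : M →ₗ[S] K) : Prop :=
  ∀ X : ModuleCat.{u} S, 𝒳 X →
    Function.Injective (fun φ : K →ₗ[S] X => φ ∘ₗ g) ∧
    Function.Exact (fun φ : K →ₗ[S] X => φ ∘ₗ g) (fun φ : M →ₗ[S] X => φ ∘ₗ f) ∧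
    Function.Surjective (fun φ : M →ₗ[S] X => φ ∘ₗ f)

/-- There is an exact sequence `0 → X_n → ⋯ → X_1 → X_0 → N → 0` with all `X_i` in `𝒳`
(continued to the left by `X_i = 0` for `i > n`). -/
def HasResolutionOfLength (𝒳 : ModuleCat.{u} S → Prop) (N : ModuleCat.{u} S) (n : ℕ) : Prop :=
  ∃ (X : ℕ → ModuleCat.{u} S) (d : ∀ i, X (i + 1) →ₗ[S] X i) (ε : X 0 →ₗ[S] N),
    (∀ i, i ≤ n → 𝒳 (X i)) ∧ (∀ i, n < i → Subsingleton (X i)) ∧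
    Function.Surjective ε ∧ Function.Exact (d 0) ε ∧
    ∀ i, Function.Exact (d (i + 1)) (d i)

/-- The `𝒳`-projective dimension of `N`: the infimum of all `n` for which there is an exact
sequence `0 → X_n → ⋯ → X_0 → N → 0` with all `X_i` in `𝒳`, and `⊤` if there is none. -/
noncomputable def relPd (𝒳 : ModuleCat.{u} S → Prop) (N : ModuleCat.{u} S) : ℕ∞ :=
  ⨅ (n : ℕ) (_ : HasResolutionOfLength 𝒳 N n), (n : ℕ∞)

/-- `K` is an `n`-th syzygy `Ω^n(N)` of `N`: `Ω^0(N) = N`, and `Ω^(n+1)(N)` is an `n`-th syzygy of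
the kernel of a surjection from a projective module onto `N`. Syzygies depend on the choice of
these surjections, so this is a relation. -/
def IsSyzygy : ℕ → ModuleCat.{u} S → ModuleCat.{u} S → Prop
  | 0, N, K => Nonempty (K ≃ₗ[S] N)
  | n + 1, N, K => ∃ (P : ModuleCat.{u} S) (p : P →ₗ[S] N), Module.Projective S P ∧
      Function.Surjective p ∧ IsSyzygy n (ModuleCat.of S (LinearMap.ker p)) K

end Dimension

end AuslanderClass

open AuslanderClass

/-!
A character of `C ⊗_S N` is a homomorphism from `N` to the character module `C⁺` of the right module
`C`, so `Tor_i(C, N) = 0` if and only if `Ext^i(N, C⁺) = 0`, and every vanishing condition becomes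
one on `Ext`. The class `𝒜_C(S)` is resolving, and if `0 → L → M → K → 0` is exact with `L` and `M`
in `𝒜_C(S)`, then `K` is in `𝒜_C(S)` as soon as `Ext^1(K, C⁺) = 0`. For a module of finite dimension
with respect to `𝒜_C(S)`, dimension shifting therefore reads the dimension off `Ext^i(-, C⁺)`.

The modules `Hom_R(C, I)` with `I` injective form an injective cogenerator of `𝒜_C(S)`: they lie in
`𝒜_C(S)` because tensor evaluation `C ⊗_S Hom_R(C, I) → I` is an isomorphism, and `N` in `𝒜_C(S)`
embeds into `Hom_R(C, J)`, where `J` is an injective module containing `C ⊗_S N`. As in the theory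
of Auslander and Buchweitz, pushouts then turn an `𝒜_C(S)`-resolution of `N` into the sequences
`0 → H → A → N → 0` and `0 → N → H' → A' → 0`.
-/

namespace AuslanderClass

section Ext

variable {A : Type u} [Ring A] {L M K X Y Z : ModuleCat.{u} A}

lemma IsShortExact.shortExact {f : L →ₗ[A] M} {g : M →ₗ[A] K} (h : IsShortExact f g) :
    (ShortComplex.mk (ModuleCat.ofHom f) (ModuleCat.ofHom g)
      (ModuleCat.hom_ext h.2.1.linearMap_comp_eq_zero)).ShortExact where
  exact := (ShortComplex.ShortExact.moduleCat_exact_iff_function_exact _).2 h.2.1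
  mono_f := (ModuleCat.mono_iff_injective _).2 h.1
  epi_g := (ModuleCat.epi_iff_surjective _).2 h.2.2

lemma isShortExact_ker_subtype {p : M →ₗ[A] K} (hp : Function.Surjective p) :
    IsShortExact (L := ModuleCat.of A (LinearMap.ker p)) (LinearMap.ker p).subtype p :=
  ⟨Subtype.val_injective, LinearMap.exact_subtype_ker_map p, hp⟩

lemma isShortExact_range_mkQ {f : L →ₗ[A] M} (hf : Function.Injective f) :
    IsShortExact (K := ModuleCat.of A (M ⧸ LinearMap.range f)) f (LinearMap.range f).mkQ :=
  ⟨hf, LinearMap.exact_map_mkQ_range f, Submodule.mkQ_surjective _⟩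

/-- `Ext^i(X, Y) = 0`. -/
abbrev ExtZero (X Y : ModuleCat.{u} A) (i : ℕ) : Prop := Subsingleton (Abelian.Ext.{u} X Y i)

lemma extZero_of_retract_left (s : X →ₗ[A] Y) (r : Y →ₗ[A] X) (hrs : r ∘ₗ s = LinearMap.id)
    {i : ℕ} (hY : ExtZero Y Z i) : ExtZero X Z i := by
  refine subsingleton_of_forall_eq 0 fun x => ?_
  have comp_eq_id : ModuleCat.ofHom s ≫ ModuleCat.ofHom r = 𝟙 X := ModuleCat.hom_ext hrs
  have pullback_eq_zero : (Abelian.Ext.mk₀ (ModuleCat.ofHom r)).comp x (zero_add i) = 0 :=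
    Subsingleton.elim _ _
  calc x = (Abelian.Ext.mk₀ (ModuleCat.ofHom s)).comp
        ((Abelian.Ext.mk₀ (ModuleCat.ofHom r)).comp x (zero_add i)) (zero_add i) := by
        simp [← Abelian.Ext.comp_assoc_of_second_deg_zero, comp_eq_id]
    _ = 0 := by rw [pullback_eq_zero, Abelian.Ext.comp_zero]

lemma extZero_of_retract_right (s : X →ₗ[A] Y) (r : Y →ₗ[A] X) (hrs : r ∘ₗ s = LinearMap.id)
    {i : ℕ} (hY : ExtZero Z Y i) : ExtZero Z X i := by
  refine subsingleton_of_forall_eq 0 fun x => ?_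
  have comp_eq_id : ModuleCat.ofHom s ≫ ModuleCat.ofHom r = 𝟙 X := ModuleCat.hom_ext hrs
  have pushforward_eq_zero : x.comp (Abelian.Ext.mk₀ (ModuleCat.ofHom s)) (add_zero i) = 0 :=
    Subsingleton.elim _ _
  calc x = (x.comp (Abelian.Ext.mk₀ (ModuleCat.ofHom s)) (add_zero i)).comp
        (Abelian.Ext.mk₀ (ModuleCat.ofHom r)) (add_zero i) := by simp [comp_eq_id]
    _ = 0 := by rw [pushforward_eq_zero, Abelian.Ext.zero_comp]

lemma extZero_congr_right (e : X ≃ₗ[A] Y) {i : ℕ} (hY : ExtZero Z Y i) : ExtZero Z X i :=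
  extZero_of_retract_right e.toLinearMap e.symm.toLinearMap e.symm_comp hY

lemma extZero_of_projective [Module.Projective A X] {i : ℕ} (hi : 1 ≤ i) : ExtZero X Y i := by
  obtain ⟨i, rfl⟩ := Nat.exists_eq_add_of_le' hi
  have : Projective X := (IsProjective.iff_projective (R := A) X).1 inferInstance
  exact Abelian.Ext.subsingleton_of_projective X Y i

lemma extZero_of_injective [Module.Injective A Y] {i : ℕ} (hi : 1 ≤ i) : ExtZero X Y i := by
  obtain ⟨i, rfl⟩ := Nat.exists_eq_add_of_le' hi
  have : Injective Y := Module.injective_object_of_injective_module A Y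
  exact Abelian.Ext.subsingleton_of_injective X Y i

lemma extZero_iff_of_projectiveResolution (P : ProjectiveResolution X) (i : ℕ) :
    ExtZero X Y (i + 1) ↔ ∀ φ : P.complex.X (i + 1) ⟶ Y, P.complex.d (i + 2) (i + 1) ≫ φ = 0 →
      ∃ ψ : P.complex.X i ⟶ Y, P.complex.d (i + 1) i ≫ ψ = φ := by
  refine ⟨fun h φ hφ => ?_, fun H => subsingleton_of_forall_eq 0 fun x => ?_⟩
  · exact (P.extMk_eq_zero_iff φ (i + 2) rfl hφ i rfl).1 (Subsingleton.elim _ _)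
  · obtain ⟨φ, hφ, rfl⟩ := P.extMk_surjective x (i + 2) rfl
    exact (P.extMk_eq_zero_iff φ (i + 2) rfl hφ i rfl).2 (H φ hφ)

namespace IsShortExact

variable {f : L →ₗ[A] M} {g : M →ₗ[A] K}

lemma comp_eq_zero_iff (h : IsShortExact f g) {T : Type*} [AddCommGroup T] [Module A T]
    (φ : M →ₗ[A] T) : φ ∘ₗ f = 0 ↔ ∃ ψ : K →ₗ[A] T, ψ ∘ₗ g = φ := by
  refine ⟨fun hφ => ?_, ?_⟩
  · have range_le_ker : LinearMap.range f ≤ LinearMap.ker φ := LinearMap.range_le_ker_iff.2 hφ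
    exact ⟨(LinearMap.range f).liftQ φ range_le_ker ∘ₗ
      (h.2.1.linearEquivOfSurjective h.2.2).symm.toLinearMap, LinearMap.ext fun m => by simp⟩
  · rintro ⟨ψ, rfl⟩
    rw [LinearMap.comp_assoc, h.2.1.linearMap_comp_eq_zero, LinearMap.comp_zero]

lemma extZero_left₁ (h : IsShortExact f g) {i : ℕ} (hM : ExtZero M Y i)
    (hK : ExtZero K Y (i + 1)) : ExtZero L Y i := by
  refine subsingleton_of_forall_eq 0 fun x => ?_
  obtain ⟨y, rfl⟩ := Abelian.Ext.contravariant_sequence_exact₁ h.shortExact Y x (add_comm 1 i)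
    (Subsingleton.elim (h := hK) _ _)
  rw [Subsingleton.elim (h := hM) y 0, Abelian.Ext.comp_zero]

lemma extZero_left₂ (h : IsShortExact f g) {i : ℕ} (hL : ExtZero L Y i) (hK : ExtZero K Y i) :
    ExtZero M Y i := by
  refine subsingleton_of_forall_eq 0 fun x => ?_
  obtain ⟨y, rfl⟩ := Abelian.Ext.contravariant_sequence_exact₂ h.shortExact Y x
    (Subsingleton.elim (h := hL) _ _)
  rw [Subsingleton.elim (h := hK) y 0, Abelian.Ext.comp_zero]

lemma extZero_left₃ (h : IsShortExact f g) {i : ℕ} (hL : ExtZero L Y i)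
    (hM : ExtZero M Y (i + 1)) : ExtZero K Y (i + 1) := by
  refine subsingleton_of_forall_eq 0 fun x => ?_
  obtain ⟨y, rfl⟩ := Abelian.Ext.contravariant_sequence_exact₃ h.shortExact Y x
    (Subsingleton.elim (h := hM) _ _) (add_comm 1 i)
  rw [Subsingleton.elim (h := hL) y 0, Abelian.Ext.comp_zero]

lemma extZero_right₁ (h : IsShortExact f g) {i : ℕ} (hM : ExtZero X M (i + 1))
    (hK : ExtZero X K i) : ExtZero X L (i + 1) := by
  refine subsingleton_of_forall_eq 0 fun x => ?_
  obtain ⟨y, rfl⟩ := Abelian.Ext.covariant_sequence_exact₁ X h.shortExact x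
    (Subsingleton.elim (h := hM) _ _) rfl
  rw [Subsingleton.elim (h := hK) y 0, Abelian.Ext.zero_comp]

lemma extZero_right₂ (h : IsShortExact f g) {i : ℕ} (hL : ExtZero X L i) (hK : ExtZero X K i) :
    ExtZero X M i := by
  refine subsingleton_of_forall_eq 0 fun x => ?_
  obtain ⟨y, rfl⟩ := Abelian.Ext.covariant_sequence_exact₂ X h.shortExact x
    (Subsingleton.elim (h := hK) _ _)
  rw [Subsingleton.elim (h := hL) y 0, Abelian.Ext.zero_comp]

lemma extZero_right₃ (h : IsShortExact f g) {i : ℕ} (hL : ExtZero X L (i + 1))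
    (hM : ExtZero X M i) : ExtZero X K i := by
  refine subsingleton_of_forall_eq 0 fun x => ?_
  obtain ⟨y, rfl⟩ := Abelian.Ext.covariant_sequence_exact₃ X h.shortExact x rfl
    (Subsingleton.elim (h := hL) _ _)
  rw [Subsingleton.elim (h := hM) y 0, Abelian.Ext.zero_comp]

lemma exists_extend (h : IsShortExact f g) (hK : ExtZero K Y 1) (φ : L →ₗ[A] Y) :
    ∃ ψ : M →ₗ[A] Y, ψ ∘ₗ f = φ := by
  obtain ⟨y, hy⟩ := Abelian.Ext.contravariant_sequence_exact₁ h.shortExact Y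
    (Abelian.Ext.mk₀ (ModuleCat.ofHom φ)) (add_zero 1) (Subsingleton.elim (h := hK) _ _)
  obtain ⟨ψ, rfl⟩ := (Abelian.Ext.mk₀_bijective _ _).2 y
  rw [Abelian.Ext.mk₀_comp_mk₀] at hy
  exact ⟨ψ.hom, congrArg ModuleCat.Hom.hom ((Abelian.Ext.mk₀_bijective _ _).1 hy)⟩

lemma extZero_one_of_exists_extend (h : IsShortExact f g) (hM : ExtZero M Y 1)
    (hext : ∀ φ : L →ₗ[A] Y, ∃ ψ : M →ₗ[A] Y, ψ ∘ₗ f = φ) : ExtZero K Y 1 := by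
  refine subsingleton_of_forall_eq 0 fun x => ?_
  obtain ⟨y, rfl⟩ := Abelian.Ext.contravariant_sequence_exact₃ h.shortExact Y x
    (Subsingleton.elim (h := hM) _ _) (add_zero 1)
  obtain ⟨φ, rfl⟩ := (Abelian.Ext.mk₀_bijective _ _).2 y
  obtain ⟨ψ, hψ⟩ := hext φ.hom
  obtain rfl : ModuleCat.ofHom f ≫ ModuleCat.ofHom ψ = φ := ModuleCat.hom_ext hψ
  rw [← Abelian.Ext.mk₀_comp_mk₀]
  exact h.shortExact.extClass_comp_assoc _

lemma exists_lift (h : IsShortExact f g) (hL : ExtZero X L 1) (φ : X →ₗ[A] K) :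
    ∃ ψ : X →ₗ[A] M, g ∘ₗ ψ = φ := by
  obtain ⟨y, hy⟩ := Abelian.Ext.covariant_sequence_exact₃ X h.shortExact
    (Abelian.Ext.mk₀ (ModuleCat.ofHom φ)) (zero_add 1) (Subsingleton.elim (h := hL) _ _)
  obtain ⟨ψ, rfl⟩ := (Abelian.Ext.mk₀_bijective _ _).2 y
  rw [Abelian.Ext.mk₀_comp_mk₀] at hy
  exact ⟨ψ.hom, congrArg ModuleCat.Hom.hom ((Abelian.Ext.mk₀_bijective _ _).1 hy)⟩

lemma extZero_one_of_exists_lift (h : IsShortExact f g) (hM : ExtZero X M 1)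
    (hlift : ∀ φ : X →ₗ[A] K, ∃ ψ : X →ₗ[A] M, g ∘ₗ ψ = φ) : ExtZero X L 1 := by
  refine subsingleton_of_forall_eq 0 fun x => ?_
  obtain ⟨y, rfl⟩ := Abelian.Ext.covariant_sequence_exact₁ X h.shortExact x
    (Subsingleton.elim (h := hM) _ _) (zero_add 1)
  obtain ⟨φ, rfl⟩ := (Abelian.Ext.mk₀_bijective _ _).2 y
  obtain ⟨ψ, hψ⟩ := hlift φ.hom
  obtain rfl : ModuleCat.ofHom ψ ≫ ModuleCat.ofHom g = φ := ModuleCat.hom_ext hψ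
  rw [← Abelian.Ext.mk₀_comp_mk₀, Abelian.Ext.comp_assoc_of_second_deg_zero,
    h.shortExact.comp_extClass, Abelian.Ext.comp_zero]

end IsShortExact

end Ext

section Character

variable {X Y Z : Type*} [AddCommGroup X] [AddCommGroup Y] [AddCommGroup Z]

lemma exists_character_extend (f : X →+ Y) (hf : Function.Injective f)
    (χ : X →+ AddCircle (1 : ℚ)) : ∃ χ' : Y →+ AddCircle (1 : ℚ), χ'.comp f = χ :=
  CharacterModule.dual_surjective_of_injective f.toIntLinearMap hf χ

lemma injective_iff_exists_character_extend (f : X →+ Y) :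
    Function.Injective f ↔
      ∀ χ : X →+ AddCircle (1 : ℚ), ∃ χ' : Y →+ AddCircle (1 : ℚ), χ'.comp f = χ :=
  (CharacterModule.dual_surjective_iff_injective (f := f.toIntLinearMap)).symm

lemma bijective_iff_bijective_character_comp (f : X →+ Y) :
    Function.Bijective f ↔
      Function.Bijective fun χ : Y →+ AddCircle (1 : ℚ) => χ.comp f :=
  (CharacterModule.dual_bijective_iff_bijective (f := f.toIntLinearMap)).symm

lemma exists_character_factor (g : X →+ Y) (χ : X →+ AddCircle (1 : ℚ)) (h : g.ker ≤ χ.ker) :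
    ∃ χ' : Y →+ AddCircle (1 : ℚ), χ'.comp g = χ := by
  obtain ⟨χ', hχ'⟩ := exists_character_extend (QuotientAddGroup.kerLift g)
    (QuotientAddGroup.kerLift_injective g) (QuotientAddGroup.lift g.ker χ h)
  exact ⟨χ', AddMonoidHom.ext fun x => DFunLike.congr_fun hχ' (QuotientAddGroup.mk x)⟩

lemma exact_iff_exact_character_comp (f : X →+ Y) (g : Y →+ Z) :
    Function.Exact f g ↔
      Function.Exact (fun χ : Z →+ AddCircle (1 : ℚ) => χ.comp g) (fun χ => χ.comp f) := by
  refine ⟨fun h χ => ⟨fun hχ => ?_, ?_⟩, fun h => ?_⟩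
  · refine exists_character_factor g χ fun y hy => ?_
    obtain ⟨x, rfl⟩ := (h y).1 hy
    exact DFunLike.congr_fun hχ x
  · rintro ⟨χ', rfl⟩
    exact AddMonoidHom.ext fun x => by simp [h.apply_apply_eq_zero]
  · have comp_eq_zero : ∀ x, g (f x) = 0 := fun x =>
      CharacterModule.eq_zero_of_character_apply fun χ => DFunLike.congr_fun ((h _).2 ⟨χ, rfl⟩) x
    refine fun y => ⟨fun hy => (QuotientAddGroup.eq_zero_iff (N := f.range) y).1 ?_, ?_⟩
    · refine CharacterModule.eq_zero_of_character_apply fun c => ?_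
      let χ : Y →+ AddCircle (1 : ℚ) := AddMonoidHom.comp c (QuotientAddGroup.mk' f.range)
      obtain ⟨χ', hχ'⟩ := (h χ).1 <| AddMonoidHom.ext fun x =>
        (congrArg c ((QuotientAddGroup.eq_zero_iff (f x)).2 ⟨x, rfl⟩)).trans (map_zero c)
      calc c y = χ' (g y) := (DFunLike.congr_fun hχ' y).symm
        _ = 0 := by rw [hy, map_zero]
    · rintro ⟨x, rfl⟩
      exact comp_eq_zero x

end Character

section CharacterDual

/-- The character module `D⁺ = Hom_ℤ(D, ℚ/ℤ)` of a right `S`-module `D`, regarded as a left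
`S`-module by `(s * χ) d = χ (d * s)`. Mathlib's `CharacterModule` has an action only for a
commutative ring. -/
@[nolint unusedArguments]
def CharDual (_S D : Type u) [AddCommGroup D] : Type u := D →+ AddCircle (1 : ℚ)

variable (S D : Type u) [Ring S] [AddCommGroup D] [Module Sᵐᵒᵖ D]

instance : AddCommGroup (CharDual S D) := inferInstanceAs (AddCommGroup (D →+ AddCircle (1 : ℚ)))

instance : FunLike (CharDual S D) D (AddCircle (1 : ℚ)) :=
  inferInstanceAs (FunLike (D →+ AddCircle (1 : ℚ)) D (AddCircle (1 : ℚ)))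

instance : AddMonoidHomClass (CharDual S D) D (AddCircle (1 : ℚ)) :=
  inferInstanceAs (AddMonoidHomClass (D →+ AddCircle (1 : ℚ)) D (AddCircle (1 : ℚ)))

instance : Module S (CharDual S D) :=
  Module.compHom (R := (Sᵐᵒᵖ)ᵈᵐᵃ) (D →+ AddCircle (1 : ℚ)) (RingEquiv.opOp S).toRingHom

variable {S D}

lemma CharDual.smul_apply (s : S) (χ : CharDual S D) (d : D) : (s • χ) d = χ (op s • d) := rfl

/-- The homomorphism `χ ↦ χ ∘ a` of character modules induced by a homomorphism `a` of right
modules. -/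
def CharDual.map {D' : Type u} [AddCommGroup D'] [Module Sᵐᵒᵖ D'] (a : D →ₗ[Sᵐᵒᵖ] D') :
    CharDual S D' →ₗ[S] CharDual S D where
  toFun χ := AddMonoidHom.comp χ a.toAddMonoidHom
  map_add' _ _ := rfl
  map_smul' s χ := DFunLike.ext _ _ fun d => congrArg χ (a.map_smul (op s) d).symm

lemma CharDual.isShortExact {L M K : ModuleCat.{u} Sᵐᵒᵖ} {f : L →ₗ[Sᵐᵒᵖ] M} {g : M →ₗ[Sᵐᵒᵖ] K}
    (h : IsShortExact f g) :
    IsShortExact (L := ModuleCat.of S (CharDual S K)) (M := ModuleCat.of S (CharDual S M))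
      (K := ModuleCat.of S (CharDual S L)) (CharDual.map g) (CharDual.map f) :=
  ⟨fun _ _ hχ => (AddMonoidHom.cancel_right h.2.2).1 hχ,
    (exact_iff_exact_character_comp f.toAddMonoidHom g.toAddMonoidHom).1 h.2.1,
    exists_character_extend f.toAddMonoidHom h.1⟩

lemma CharDual.injective [Module.Projective Sᵐᵒᵖ D] : Module.Injective S (CharDual S D) where
  out X Y _ _ _ _ f hf g := by
    obtain ⟨s, hs⟩ := ‹Module.Projective Sᵐᵒᵖ D›
    choose χ hχ using fun q : D => exists_character_extend f.toAddMonoidHom hf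
      (AddMonoidHom.mk' (fun x => g x q) fun x y => by rw [map_add]; rfl)
    -- As `d = ∑ q, s d q • q`, the map `g` sends `x` to `d ↦ ∑ q, g (s d q • x) q`.
    let h : Y →ₗ[S] CharDual S D :=
      { toFun := fun y => (AddMonoidHom.mk' (fun d => (s d).sum fun q a => χ q (unop a • y))
          fun d e => by
            rw [map_add]
            exact Finsupp.sum_add_index' (by simp) (by simp [add_smul]) : D →+ AddCircle (1 : ℚ))
        map_add' := fun y z => DFunLike.ext _ _ fun d => by
          have sum_add : (s d).sum (fun q a => χ q (unop a • (y + z))) =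
              (s d).sum (fun q a => χ q (unop a • y)) +
                (s d).sum fun q a => χ q (unop a • z) := by
            simp only [smul_add, map_add, Finsupp.sum_add]
          exact sum_add
        map_smul' := fun t y => DFunLike.ext _ _ fun d => by
          have smul_sum : (s (op t • d)).sum (fun q a => χ q (unop a • y)) =
              (s d).sum fun q a => χ q (unop a • t • y) := by
            rw [map_smul, Finsupp.sum_smul_index' (by simp)]
            simp [mul_smul]
          exact smul_sum.symm }
    refine ⟨h, fun x => DFunLike.ext _ _ fun d => ?_⟩
    calc h (f x) d = (s d).sum fun q a => χ q (f (unop a • x)) := by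
          simp only [map_smul]; rfl
      _ = (s d).sum fun q a => g x (a • q) := by
          refine Finsupp.sum_congr fun q _ => ?_
          rw [show χ q (f _) = g _ q from DFunLike.congr_fun (hχ q) _, map_smul]
          rfl
      _ = g x d := by
          rw [← map_finsuppSum]
          exact congrArg (g x) (hs d)

end CharacterDual

section Tensor

variable {R S C : Type u} [Ring R] [Ring S] [AddCommGroup C] [Module R C] [Module Sᵐᵒᵖ C]
  [SMulCommClass R Sᵐᵒᵖ C]
variable {N N' N'' : Type u} [AddCommGroup N] [Module S N] [AddCommGroup N'] [Module S N']
  [AddCommGroup N''] [Module S N'']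

lemma BTensor.induction {p : BTensor R S C N → Prop} (zero : p 0)
    (btmul : ∀ c x, p (btmul R S C c x)) (add : ∀ a b, p a → p b → p (a + b))
    (z : BTensor R S C N) : p z := by
  obtain ⟨z, rfl⟩ := Submodule.mkQ_surjective (balancedSubmodule R S C N) z
  induction z using TensorProduct.induction_on with
  | zero => rw [map_zero]; exact zero
  | tmul c x => exact btmul c x
  | add a b ha hb => rw [map_add]; exact add _ _ ha hb

lemma BTensor.addHom_ext {Z : Type*} [AddCommGroup Z] {f g : BTensor R S C N →+ Z}
    (h : ∀ c x, f (btmul R S C c x) = g (btmul R S C c x)) : f = g := by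
  ext z
  induction z using BTensor.induction with
  | zero => rw [map_zero, map_zero]
  | btmul c x => exact h c x
  | add a b ha hb => rw [map_add, map_add, ha, hb]

/-- The homomorphism `c ⊗ x ↦ β c x` induced by a balanced biadditive map `β`. -/
def BTensor.liftAddHom {Z : Type*} [AddCommGroup Z] (β : C →+ N →+ Z)
    (balanced : ∀ c (s : S) x, β (op s • c) x = β c (s • x)) : BTensor R S C N →+ Z :=
  QuotientAddGroup.lift (balancedSubmodule R S C N).toAddSubgroup
    (TensorProduct.liftAddHom β fun r c x => by simp) <| by
      refine (AddSubgroup.closure_le _).2 ?_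
      rintro _ ⟨c, s, x, rfl⟩
      simp [balanced]

lemma BTensor.map_comp (f : N →ₗ[S] N') (g : N' →ₗ[S] N'') :
    BTensor.map R S C (g ∘ₗ f) = BTensor.map R S C g ∘ₗ BTensor.map R S C f :=
  BTensor.hom_ext fun _ _ => rfl

lemma BTensor.map_id : BTensor.map R S C (LinearMap.id : N →ₗ[S] N) = LinearMap.id :=
  BTensor.hom_ext fun _ _ => rfl

lemma BTensor.map_surjective {f : N →ₗ[S] N'} (hf : Function.Surjective f) :
    Function.Surjective (BTensor.map R S C f) := by
  intro z
  induction z using BTensor.induction with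
  | zero => exact ⟨0, map_zero _⟩
  | btmul c x =>
    obtain ⟨y, rfl⟩ := hf x
    exact ⟨btmul R S C c y, rfl⟩
  | add a b ha hb =>
    obtain ⟨a, rfl⟩ := ha
    obtain ⟨b, rfl⟩ := hb
    exact ⟨a + b, map_add _ _ _⟩

/-- The adjunction isomorphism `(C ⊗_S N)⁺ ≃ Hom_S(N, C⁺)`. -/
def charAdj : (BTensor R S C N →+ AddCircle (1 : ℚ)) ≃+ (N →ₗ[S] CharDual S C) where
  toFun χ :=
    { toFun := fun x => (AddMonoidHom.mk' (fun c => χ (btmul R S C c x)) fun c d => by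
        rw [add_btmul, map_add] : C →+ AddCircle (1 : ℚ))
      map_add' := fun x y => DFunLike.ext _ _ fun c =>
        (congrArg χ (btmul_add R S C c x y)).trans (map_add χ _ _)
      map_smul' := fun s x => DFunLike.ext _ _ fun c => congrArg χ (btmul_smul R c s x).symm }
  invFun φ := BTensor.liftAddHom
    (AddMonoidHom.mk' (fun c => AddMonoidHom.mk' (fun x => φ x c) fun x y => by
      rw [map_add]; rfl) fun c d => AddMonoidHom.ext fun x => map_add (φ x) c d)
    fun c s x => by
      change φ x (op s • c) = φ (s • x) c
      rw [φ.map_smul, CharDual.smul_apply]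
  left_inv _ := BTensor.addHom_ext fun _ _ => rfl
  right_inv _ := rfl
  map_add' _ _ := rfl

lemma BTensor.map_injective_iff (f : N →ₗ[S] N') :
    Function.Injective (BTensor.map R S C f) ↔
      ∀ φ : N →ₗ[S] CharDual S C, ∃ ψ : N' →ₗ[S] CharDual S C, ψ ∘ₗ f = φ := by
  refine (injective_iff_exists_character_extend (BTensor.map R S C f).toAddMonoidHom).trans ?_
  exact charAdj.toEquiv.forall_congr fun χ => charAdj.toEquiv.exists_congr fun χ' =>
    charAdj.injective.eq_iff.symm

lemma BTensor.map_exact_iff (f : N →ₗ[S] N') (g : N' →ₗ[S] N'') :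
    Function.Exact (BTensor.map R S C f) (BTensor.map R S C g) ↔
      ∀ φ : N' →ₗ[S] CharDual S C,
        φ ∘ₗ f = 0 ↔ ∃ ψ : N'' →ₗ[S] CharDual S C, ψ ∘ₗ g = φ := by
  refine (exact_iff_exact_character_comp (BTensor.map R S C f).toAddMonoidHom
    (BTensor.map R S C g).toAddMonoidHom).trans ?_
  exact charAdj.toEquiv.forall_congr fun χ => iff_congr charAdj.map_eq_zero_iff.symm <|
    charAdj.toEquiv.exists_congr fun χ' => charAdj.injective.eq_iff.symm

lemma BTensor.isShortExact {L M K : ModuleCat.{u} S} {f : L →ₗ[S] M} {g : M →ₗ[S] K}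
    (h : IsShortExact f g) (hf : Function.Injective (BTensor.map R S C f)) :
    IsShortExact (L := ModuleCat.of R (BTensor R S C L)) (M := ModuleCat.of R (BTensor R S C M))
      (K := ModuleCat.of R (BTensor R S C K)) (BTensor.map R S C f) (BTensor.map R S C g) :=
  ⟨hf, (map_exact_iff f g).2 h.comp_eq_zero_iff, map_surjective h.2.2⟩

end Tensor

section Tor

variable {R S C : Type u} [Ring R] [Ring S] [AddCommGroup C] [Module R C] [Module Sᵐᵒᵖ C]
  [SMulCommClass R Sᵐᵒᵖ C] {N : ModuleCat.{u} S}

lemma subsingleton_torC_iff_exact (P : ProjectiveResolution N) (i : ℕ) :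
    Subsingleton (TorC R S C (i + 1) N) ↔
      Function.Exact (BTensor.map R S C (P.complex.d (i + 2) (i + 1)).hom)
        (BTensor.map R S C (P.complex.d (i + 1) i).hom) := by
  let K := ((tensorFunctor R S C).mapHomologicalComplex _).obj P.complex
  have isZero_iff : Limits.IsZero (TorC R S C (i + 1) N) ↔ Limits.IsZero (K.homology (i + 1)) :=
    (P.isoLeftDerivedObj (tensorFunctor R S C) (i + 1)).isZero_iff
  rw [← ModuleCat.isZero_iff_subsingleton, isZero_iff,
    ← HomologicalComplex.exactAt_iff_isZero_homology,
    HomologicalComplex.exactAt_iff' K (i + 2) (i + 1) i (by simp) (by simp),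
    ShortComplex.ShortExact.moduleCat_exact_iff_function_exact]
  rfl

lemma subsingleton_torC_iff_extZero_charDual {i : ℕ} (hi : 1 ≤ i) :
    Subsingleton (TorC R S C i N) ↔ ExtZero N (ModuleCat.of S (CharDual S C)) i := by
  obtain ⟨i, rfl⟩ := Nat.exists_eq_add_of_le' hi
  let P := projectiveResolution N
  have d_comp_d : (P.complex.d (i + 1) i).hom ∘ₗ (P.complex.d (i + 2) (i + 1)).hom = 0 :=
    congrArg ModuleCat.Hom.hom (P.complex.d_comp_d (i + 2) (i + 1) i)
  rw [subsingleton_torC_iff_exact P, extZero_iff_of_projectiveResolution P, BTensor.map_exact_iff]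
  refine ⟨fun h φ hφ => ?_, fun h φ => ⟨fun hφ => ?_, ?_⟩⟩
  · obtain ⟨ψ, hψ⟩ := (h φ.hom).1 (congrArg ModuleCat.Hom.hom hφ)
    exact ⟨ModuleCat.ofHom ψ, ModuleCat.hom_ext hψ⟩
  · obtain ⟨ψ, hψ⟩ := h (ModuleCat.ofHom φ) (ModuleCat.hom_ext hφ)
    exact ⟨ψ.hom, congrArg ModuleCat.Hom.hom hψ⟩
  · rintro ⟨ψ, rfl⟩
    rw [LinearMap.comp_assoc, d_comp_d, LinearMap.comp_zero]

end Tor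

section HomAdjunction

variable {R S C : Type u} [Ring R] [Ring S] [AddCommGroup C] [Module R C] [Module Sᵐᵒᵖ C]
  [SMulCommClass R Sᵐᵒᵖ C]
variable {N J J' : Type u} [AddCommGroup J'] [Module R J'] [AddCommGroup N] [Module S N]
  [AddCommGroup J] [Module R J]

/-- The homomorphism `Hom_R(C, a) : Hom_R(C, J) → Hom_R(C, J')`, `f ↦ a ∘ f`. -/
def HomC.map (a : J →ₗ[R] J') : HomC R S C J →ₗ[S] HomC R S C J' where
  toFun f := HomC.ofLin (a ∘ₗ f.toLin)
  map_add' f g := HomC.ext fun c => map_add a (f.toLin c) (g.toLin c)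
  map_smul' _ _ := rfl

lemma HomC.map_injective {a : J →ₗ[R] J'} (ha : Function.Injective a) :
    Function.Injective (HomC.map a : HomC R S C J →ₗ[S] HomC R S C J') :=
  fun _ _ h => LinearMap.cancel_left ha |>.1 h

/-- The adjunction isomorphism `Hom_R(C ⊗_S N, J) ≃ Hom_S(N, Hom_R(C, J))`. -/
def homAdj : (BTensor R S C N →ₗ[R] J) ≃ (N →ₗ[S] HomC R S C J) where
  toFun t := HomC.map t ∘ₗ muC R S C N
  invFun φ :=
    let t : BTensor R S C N →+ J := BTensor.liftAddHom
      (AddMonoidHom.mk' (fun c => AddMonoidHom.mk' (fun x => (φ x).toLin c) fun x y => by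
        rw [map_add]; rfl) fun c d => AddMonoidHom.ext fun x => map_add (φ x).toLin c d)
      fun c s x => congrArg (fun f : HomC R S C J => f.toLin c) (φ.map_smul s x).symm
    { t with
      map_smul' := fun r z => by
        change t (r • z) = r • t z
        induction z using BTensor.induction with
        | zero => rw [smul_zero, map_zero, smul_zero]
        | btmul c x => exact (φ x).toLin.map_smul r c
        | add a b ha hb => rw [smul_add, map_add, ha, hb, map_add, smul_add] }
  left_inv _ := BTensor.hom_ext fun _ _ => rfl
  right_inv _ := rfl

lemma homAdj_symm_btmul (φ : N →ₗ[S] HomC R S C J) (c : C) (x : N) :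
    homAdj.symm φ (btmul R S C c x) = (φ x).toLin c := rfl

end HomAdjunction

section FiniteResolution

variable {A : Type u} [Ring A]

/-- The module `M` is of type `FP_∞`. This is `HasDegreewiseFiniteResolution` written out with
linear maps, so that the kernel of the augmentation is resolved by a mere shift of indices. -/
def IsFPInfty (M : ModuleCat.{u} A) : Prop :=
  ∃ (P : ℕ → ModuleCat.{u} A) (d : ∀ i, P (i + 1) →ₗ[A] P i) (ε : P 0 →ₗ[A] M),
    (∀ i, Module.Finite A (P i)) ∧ (∀ i, Module.Projective A (P i)) ∧
    Function.Surjective ε ∧ Function.Exact (d 0) ε ∧ ∀ i, Function.Exact (d (i + 1)) (d i)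

lemma HasDegreewiseFiniteResolution.isFPInfty {M : ModuleCat.{u} A}
    (h : HasDegreewiseFiniteResolution M) : IsFPInfty M := by
  obtain ⟨P, hP⟩ := h
  let e := HomologicalComplex.singleObjXSelf (ComplexShape.down ℕ) 0 M
  refine ⟨P.complex.X, fun i => (P.complex.d (i + 1) i).hom, (P.π.f 0 ≫ e.hom).hom, hP,
    fun i => (IsProjective.iff_projective (R := A) _).2 (P.projective i), ?_, ?_, fun i => ?_⟩
  · exact (ModuleCat.epi_iff_surjective _).1 (epi_comp (P.π.f 0) e.hom)
  · have exact_π := (ShortComplex.ShortExact.moduleCat_exact_iff_function_exact _).1 P.exact₀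
    exact fun x => (map_eq_zero_iff e.hom.hom
      ((ModuleCat.mono_iff_injective e.hom).1 inferInstance)).trans (exact_π x)
  · exact (ShortComplex.ShortExact.moduleCat_exact_iff_function_exact _).1 (P.exact_succ i)

lemma IsFPInfty.exists_ker {M : ModuleCat.{u} A} (h : IsFPInfty M) :
    ∃ (Q : ModuleCat.{u} A) (p : Q →ₗ[A] M), Module.Finite A Q ∧ Module.Projective A Q ∧
      Function.Surjective p ∧ IsFPInfty (ModuleCat.of A (LinearMap.ker p)) := by
  obtain ⟨P, d, ε, finite, projective, hε, exact_ε, exact_d⟩ := h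
  refine ⟨P 0, ε, finite 0, projective 0, hε, fun i => P (i + 1), fun i => d (i + 1),
    (d 0).codRestrict (LinearMap.ker ε) fun x => exact_ε.apply_apply_eq_zero x,
    fun i => finite _, fun i => projective _, ?_, fun x => ?_, fun i => exact_d _⟩
  · rintro ⟨y, hy⟩
    obtain ⟨x, rfl⟩ := (exact_ε y).1 hy
    exact ⟨x, rfl⟩
  · exact Subtype.ext_iff.trans (exact_d 0 x)

lemma IsFPInfty.finite {M : ModuleCat.{u} A} (h : IsFPInfty M) : Module.Finite A M := by
  obtain ⟨Q, p, _, -, hp, -⟩ := h.exists_ker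
  exact Module.Finite.of_surjective p hp

section Finsupp

variable {D Q Y X : Type*} [AddCommGroup D] [Module A D] [AddCommGroup Q] [Module A Q]
  [AddCommGroup Y] [Module A Y]

lemma exists_finset_support_subset [Module.Finite A D] (φ : D →ₗ[A] X →₀ Y) :
    ∃ T : Finset X, ∀ d, (φ d).support ⊆ T := by
  classical
  obtain ⟨s, hs⟩ := Module.Finite.fg_top (R := A) (M := D)
  let T : Finset X := s.biUnion fun d => (φ d).support
  have top_le : ⊤ ≤ (Finsupp.supported Y A (T : Set X)).comap φ := by
    rw [← hs, Submodule.span_le]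
    exact fun d hd => Finset.coe_subset.2 (Finset.subset_biUnion_of_mem (fun d => (φ d).support) hd)
  exact ⟨T, fun d => Finset.coe_subset.1 (top_le (Submodule.mem_top (x := d)))⟩

lemma exists_finsupp_extend [Module.Finite A D] (f : D →ₗ[A] Q) (φ : D →ₗ[A] X →₀ Y)
    (h : ∀ x, ∃ ψ : Q →ₗ[A] Y, ψ ∘ₗ f = Finsupp.lapply x ∘ₗ φ) :
    ∃ ψ : Q →ₗ[A] X →₀ Y, ψ ∘ₗ f = φ := by
  obtain ⟨T, hT⟩ := exists_finset_support_subset φ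
  choose ψ hψ using h
  refine ⟨∑ x ∈ T, Finsupp.lsingle x ∘ₗ ψ x, LinearMap.ext fun d => ?_⟩
  calc (∑ x ∈ T, Finsupp.lsingle x ∘ₗ ψ x) (f d) = ∑ x ∈ T, Finsupp.single x (ψ x (f d)) := by
        simp only [LinearMap.sum_apply, LinearMap.comp_apply, Finsupp.lsingle_apply]
    _ = ∑ x ∈ T, Finsupp.single x (φ d x) :=
        Finset.sum_congr rfl fun x _ => congrArg _ (LinearMap.congr_fun (hψ x) d)
    _ = φ d := by
        rw [← Finsupp.sum_of_support_subset _ (hT d) _ fun _ _ => Finsupp.single_zero _,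
          Finsupp.sum_single]

end Finsupp

lemma IsFPInfty.extZero_finsupp {D Y : ModuleCat.{u} A} (h : IsFPInfty D)
    (hD : ∀ i, 1 ≤ i → ExtZero D Y i) (X : Type u) {i : ℕ} (hi : 1 ≤ i) :
    ExtZero D (ModuleCat.of A (X →₀ Y)) i := by
  induction i, hi using Nat.le_induction generalizing D with
  | base =>
    obtain ⟨Q, p, _, _, hp, hK⟩ := h.exists_ker
    have ker_exact := isShortExact_ker_subtype hp
    have := hK.finite
    exact ker_exact.extZero_one_of_exists_extend (extZero_of_projective le_rfl) fun φ =>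
      exists_finsupp_extend _ φ fun x => ker_exact.exists_extend (hD 1 le_rfl) _
  | succ i _ ih =>
    obtain ⟨Q, p, _, _, hp, hK⟩ := h.exists_ker
    have ker_exact := isShortExact_ker_subtype hp
    have extZero_ker : ∀ j, 1 ≤ j → ExtZero (ModuleCat.of A (LinearMap.ker p)) Y j := fun j hj =>
      ker_exact.extZero_left₁ (extZero_of_projective hj) (hD _ (by lia))
    exact ker_exact.extZero_left₃ (ih hK extZero_ker) (extZero_of_projective (by lia))

end FiniteResolution

section Projective

variable {R S C : Type u} [Ring R] [Ring S] [AddCommGroup C] [Module R C] [Module Sᵐᵒᵖ C]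
  [SMulCommClass R Sᵐᵒᵖ C]

lemma inAuslander_iff {N : ModuleCat.{u} S} : InAuslander R S C N ↔
    (∀ i : ℕ, 1 ≤ i → ExtZero N (ModuleCat.of S (CharDual S C)) i) ∧
    (∀ i : ℕ, 1 ≤ i → ExtZero (ModuleCat.of R C) (ModuleCat.of R (BTensor R S C N)) i) ∧
    Function.Bijective (muC R S C N) :=
  ⟨fun h => ⟨fun _ hi => (subsingleton_torC_iff_extZero_charDual hi).1 (h.1 _ hi), h.2, h.3⟩,
    fun h => ⟨fun _ hi => (subsingleton_torC_iff_extZero_charDual hi).2 (h.1 _ hi), h.2.1, h.2.2⟩⟩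

lemma InAuslander.extZero_charDual {N : ModuleCat.{u} S} (h : InAuslander R S C N) {i : ℕ}
    (hi : 1 ≤ i) : ExtZero N (ModuleCat.of S (CharDual S C)) i := (inAuslander_iff.1 h).1 i hi

lemma InAuslander.of_retract {X Y : ModuleCat.{u} S} (hY : InAuslander R S C Y) (s : X →ₗ[S] Y)
    (r : Y →ₗ[S] X) (hrs : r ∘ₗ s = LinearMap.id) : InAuslander R S C X := by
  have map_r_map_s : BTensor.map R S C r ∘ₗ BTensor.map R S C s = LinearMap.id := by
    rw [← BTensor.map_comp, hrs, BTensor.map_id]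
  have s_injective : Function.Injective s :=
    Function.LeftInverse.injective (LinearMap.congr_fun hrs)
  have map_surjective :
      Function.Surjective (HomC.map (BTensor.map R S C r) : HomC R S C _ →ₗ[S] HomC R S C _) :=
    fun φ => ⟨HomC.map (BTensor.map R S C s) φ, HomC.ext fun c => LinearMap.congr_fun map_r_map_s _⟩
  rw [inAuslander_iff] at hY ⊢
  refine ⟨fun i hi => extZero_of_retract_left s r hrs (hY.1 i hi), fun i hi =>
    extZero_of_retract_right (X := ModuleCat.of R (BTensor R S C X))
      (Y := ModuleCat.of R (BTensor R S C Y)) _ _ map_r_map_s (hY.2.1 i hi), ?_, ?_⟩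
  · exact Function.Injective.of_comp (f := HomC.map (BTensor.map R S C s))
      (hY.2.2.1.comp s_injective)
  · exact Function.Surjective.of_comp (map_surjective.comp hY.2.2.2)

lemma InAuslander.of_equiv {X Y : ModuleCat.{u} S} (hY : InAuslander R S C Y) (e : X ≃ₗ[S] Y) :
    InAuslander R S C X :=
  hY.of_retract e.toLinearMap e.symm.toLinearMap e.symm_comp

/-- The isomorphism `C ⊗_S S^(X) ≃ C^(X)`. -/
noncomputable def tensorFinsuppEquiv (X : Type u) :
    BTensor R S C (X →₀ S) ≃ₗ[R] (X →₀ C) :=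
  LinearEquiv.ofLinearMap
    (homAdj.symm (Finsupp.linearCombination S fun x => HomC.ofLin (Finsupp.lsingle x)))
    (Finsupp.lsum ℕ fun x => (muC R S C (X →₀ S) (Finsupp.single x 1)).toLin)
    (Finsupp.lhom_ext fun x c => by
      rw [LinearMap.comp_apply, Finsupp.lsum_single]
      refine (homAdj_symm_btmul _ c _).trans ?_
      rw [Finsupp.linearCombination_single, one_smul]
      rfl)
    (homAdj.injective <| Finsupp.lhom_ext' fun x => LinearMap.ext_ring <| HomC.ext fun c => by
      change Finsupp.lsum ℕ _ (homAdj.symm _ (btmul R S C c (Finsupp.single x 1))) = _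
      rw [homAdj_symm_btmul, Finsupp.linearCombination_single, one_smul]
      exact Finsupp.lsum_single ℕ _ x c)

lemma tensorFinsuppEquiv_btmul_apply {X : Type u} (c : C) (v : X →₀ S) (x : X) :
    tensorFinsuppEquiv (R := R) X (btmul R S C c v) x = op (v x) • c := by
  change (Finsupp.linearCombination S
    (fun x => HomC.ofLin (Finsupp.lsingle x) : X → HomC R S C (X →₀ C)) v).toLin c x = _
  induction v using Finsupp.induction_linear with
  | zero =>
    rw [map_zero, Finsupp.zero_apply, MulOpposite.op_zero, zero_smul]
    rfl
  | add v w hv hw =>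
    rw [map_add, Finsupp.add_apply, MulOpposite.op_add, add_smul, ← hv, ← hw]
    rfl
  | single y s =>
    rw [Finsupp.linearCombination_single]
    change Finsupp.single y (op s • c) x = _
    classical
    rw [Finsupp.single_apply, Finsupp.single_apply]
    split_ifs <;> simp

lemma muC_finsupp_bijective [Module.Finite R C] (h : Function.Bijective (rightMul R S C))
    (X : Type u) : Function.Bijective (muC R S C (X →₀ S)) := by
  let e := tensorFinsuppEquiv (R := R) (S := S) (C := C) X
  refine ⟨fun v w hvw => Finsupp.ext fun x => h.1 (LinearMap.ext fun c => ?_), fun φ => ?_⟩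
  · have apply_eq : e (btmul R S C c v) x = e (btmul R S C c w) x :=
      congrArg (fun f : HomC R S C (BTensor R S C (X →₀ S)) => e (f.toLin c) x) hvw
    rwa [tensorFinsuppEquiv_btmul_apply, tensorFinsuppEquiv_btmul_apply] at apply_eq
  · obtain ⟨T, hT⟩ := exists_finset_support_subset (e.toLinearMap ∘ₗ φ.toLin)
    choose σ hσ using fun x : X => h.2 (Finsupp.lapply x ∘ₗ e.toLinearMap ∘ₗ φ.toLin)
    have op_σ_smul : ∀ x c, op (σ x) • c = e (φ.toLin c) x := fun x => LinearMap.congr_fun (hσ x)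
    have σ_eq_zero : ∀ x ∉ T, σ x = 0 := fun x hx => h.1 <| LinearMap.ext fun c => by
      change op (σ x) • c = op (0 : S) • c
      rw [op_σ_smul, op_zero, zero_smul]
      exact Finsupp.notMem_support_iff.1 fun hmem => hx (hT c hmem)
    let v : X →₀ S := Finsupp.onFinset T σ fun x => not_imp_comm.1 (σ_eq_zero x)
    refine ⟨v, HomC.ext fun c => e.injective (Finsupp.ext fun x => ?_)⟩
    exact (tensorFinsuppEquiv_btmul_apply c v x).trans (op_σ_smul x c)

lemma inAuslander_of_projective (hC : IsSemidualizing R S C) (P : ModuleCat.{u} S)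
    [Module.Projective S P] : InAuslander R S C P := by
  have isFPInfty := hC.finite_left.isFPInfty
  have := isFPInfty.finite
  have inAuslander_finsupp : InAuslander R S C (ModuleCat.of S (P →₀ S)) := inAuslander_iff.2
    ⟨fun i hi => extZero_of_projective hi, fun i hi =>
      extZero_congr_right (X := ModuleCat.of R (BTensor R S C (P →₀ S)))
        (Y := ModuleCat.of R (P →₀ C)) (tensorFinsuppEquiv P)
        (isFPInfty.extZero_finsupp hC.ext_left P hi),
      muC_finsupp_bijective hC.homothety_right P⟩
  obtain ⟨s, hs⟩ := Module.projective_def'.1 ‹Module.Projective S P›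
  exact inAuslander_finsupp.of_retract s _ hs

end Projective

section TensorEvaluation

attribute [local instance] SMulCommClass.symm

variable {R S C : Type u} [Ring R] [Ring S] [AddCommGroup C] [Module R C] [Module Sᵐᵒᵖ C]
  [SMulCommClass R Sᵐᵒᵖ C]
variable {D D' : Type u} [AddCommGroup D] [Module Sᵐᵒᵖ D] [AddCommGroup D'] [Module Sᵐᵒᵖ D']
variable {I : Type u} [AddCommGroup I] [Module R I]

/-- The homomorphism `Hom_R(Hom_{Sᵒᵖ}(D, C), I) → Hom_R(Hom_{Sᵒᵖ}(D', C), I)` induced by a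
homomorphism `D → D'` of right `S`-modules. -/
def bidualMap (R C I : Type u) [Ring R] [AddCommGroup C] [Module R C] [Module Sᵐᵒᵖ C]
    [SMulCommClass R Sᵐᵒᵖ C] [AddCommGroup I] [Module R I] (a : D →ₗ[Sᵐᵒᵖ] D') :
    ((D →ₗ[Sᵐᵒᵖ] C) →ₗ[R] I) →+ ((D' →ₗ[Sᵐᵒᵖ] C) →ₗ[R] I) :=
  (LinearMap.lcomp ℤ I (LinearMap.lcomp R C a)).toAddMonoidHom

/-- The character dual of the tensor evaluation map
`D ⊗_S Hom_R(C, I) → Hom_R(Hom_{Sᵒᵖ}(D, C), I)`, `d ⊗ f ↦ (h ↦ f (h d))`, with the characters of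
`D ⊗_S Hom_R(C, I)` written as homomorphisms `Hom_R(C, I) → D⁺`. -/
def tensorEvalDual : (((D →ₗ[Sᵐᵒᵖ] C) →ₗ[R] I) →+ AddCircle (1 : ℚ)) →+
    (HomC R S C I →ₗ[S] CharDual S D) where
  toFun χ :=
    { toFun := fun f => (AddMonoidHom.mk' (fun d => χ (f.toLin ∘ₗ LinearMap.applyₗ' R d))
        fun d e => by rw [map_add, LinearMap.comp_add, map_add] : D →+ AddCircle (1 : ℚ))
      map_add' := fun f g => DFunLike.ext _ _ fun d =>
        map_add χ (f.toLin ∘ₗ LinearMap.applyₗ' R d) (g.toLin ∘ₗ LinearMap.applyₗ' R d)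
      map_smul' := fun s f => DFunLike.ext _ _ fun d => congrArg χ <| LinearMap.ext fun h =>
        congrArg f.toLin (h.map_smul (op s) d).symm }
  map_zero' := rfl
  map_add' _ _ := rfl

lemma tensorEvalDual_naturality (a : D →ₗ[Sᵐᵒᵖ] D')
    (χ : ((D' →ₗ[Sᵐᵒᵖ] C) →ₗ[R] I) →+ AddCircle (1 : ℚ)) :
    tensorEvalDual (χ.comp (bidualMap R C I a)) = CharDual.map a ∘ₗ tensorEvalDual χ := rfl

lemma exists_finite_dual_basis (A Q : Type*) [Ring A] [AddCommGroup Q] [Module A Q]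
    [Module.Finite A Q] [Module.Projective A Q] :
    ∃ (n : ℕ) (q : Fin n → Q) (φ : Fin n → Q →ₗ[A] A), ∀ x, ∑ j, φ j x • q j = x := by
  obtain ⟨n, f, g, -, -, hfg⟩ := Module.Finite.exists_comp_eq_id_of_projective A Q
  refine ⟨n, fun j => f (Pi.single j 1), fun j => LinearMap.proj j ∘ₗ g, fun x => ?_⟩
  calc ∑ j, g x j • f (Pi.single j 1) = f (∑ j, g x j • Pi.single j 1) := by
        simp only [map_sum, map_smul]
    _ = f (g x) := by rw [← pi_eq_sum_univ']
    _ = x := LinearMap.congr_fun hfg x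

/-- The homomorphism `C → Hom_{Sᵒᵖ}(D, C)`, `c ↦ (d ↦ c * φ d)`, given by a functional `φ` on the
right module `D`. -/
def smulRightHom (φ : D →ₗ[Sᵐᵒᵖ] Sᵐᵒᵖ) : C →ₗ[R] (D →ₗ[Sᵐᵒᵖ] C) where
  toFun c := φ.smulRight c
  map_add' c e := LinearMap.ext fun d => smul_add (φ d) c e
  map_smul' r c := LinearMap.ext fun d => smul_comm (φ d) r c

lemma sum_comp_smulRightHom_comp_apply {n : ℕ} {q : Fin n → D} {φ : Fin n → D →ₗ[Sᵐᵒᵖ] Sᵐᵒᵖ}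
    (hq : ∀ d, ∑ j, φ j d • q j = d) (t : (D →ₗ[Sᵐᵒᵖ] C) →ₗ[R] I) :
    ∑ j, (t ∘ₗ smulRightHom (φ j)) ∘ₗ LinearMap.applyₗ' R (q j) = t := by
  refine LinearMap.ext fun h => ?_
  have sum_smulRight : ∑ j, smulRightHom (R := R) (φ j) (h (q j)) = h := LinearMap.ext fun d =>
    calc (∑ j, smulRightHom (R := R) (φ j) (h (q j))) d = ∑ j, φ j d • h (q j) :=
          LinearMap.sum_apply _ _ d
      _ = h (∑ j, φ j d • q j) := by simp only [map_sum, map_smul]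
      _ = h d := by rw [hq]
  calc (∑ j, (t ∘ₗ smulRightHom (φ j)) ∘ₗ LinearMap.applyₗ' R (q j)) h
      = ∑ j, t (smulRightHom (φ j) (h (q j))) := LinearMap.sum_apply _ _ h
    _ = t h := by rw [← map_sum, sum_smulRight]

lemma tensorEvalDual_bijective_of_projective [Module.Finite Sᵐᵒᵖ D] [Module.Projective Sᵐᵒᵖ D] :
    Function.Bijective (tensorEvalDual (R := R) (S := S) (C := C) (D := D) (I := I)) := by
  obtain ⟨n, q, φ, hq⟩ := exists_finite_dual_basis Sᵐᵒᵖ D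
  let F (t : (D →ₗ[Sᵐᵒᵖ] C) →ₗ[R] I) (j : Fin n) : HomC R S C I :=
    HomC.ofLin (t ∘ₗ smulRightHom (φ j))
  have apply_eq_sum (χ : ((D →ₗ[Sᵐᵒᵖ] C) →ₗ[R] I) →+ AddCircle (1 : ℚ)) (t) :
      χ t = ∑ j, tensorEvalDual χ (F t j) (q j) := by
    conv_lhs => rw [← sum_comp_smulRightHom_comp_apply hq t, map_sum]
    rfl
  refine ⟨fun χ ψ hχψ => AddMonoidHom.ext fun t => ?_, fun g => ?_⟩
  · rw [apply_eq_sum, apply_eq_sum, hχψ]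
  · refine ⟨AddMonoidHom.mk' (fun t => ∑ j, g (F t j) (q j)) fun t t' => ?_, ?_⟩
    · rw [← Finset.sum_add_distrib]
      exact Finset.sum_congr rfl fun j _ => DFunLike.congr_fun (map_add g (F t j) (F t' j)) (q j)
    · refine LinearMap.ext fun f => DFunLike.ext _ _ fun d => ?_
      calc ∑ j, g (F (f.toLin ∘ₗ LinearMap.applyₗ' R d) j) (q j)
          = ∑ j, g f (φ j d • q j) := Finset.sum_congr rfl fun j _ =>
            DFunLike.congr_fun (g.map_smul (unop (φ j d)) f) (q j)
        _ = g f d := by rw [← map_sum, hq]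

section Injective

variable [Module.Injective R I]

lemma exists_comp_eq_of_ker_le {M N : Type*} [AddCommGroup M] [Module R M] [AddCommGroup N]
    [Module R N] (p : M →ₗ[R] N) (t : M →ₗ[R] I) (h : LinearMap.ker p ≤ LinearMap.ker t) :
    ∃ t' : N →ₗ[R] I, t' ∘ₗ p = t := by
  obtain ⟨t', ht'⟩ := Module.Injective.extension_property R I _ _
    ((LinearMap.ker p).liftQ p le_rfl)
    (LinearMap.ker_eq_bot.1 (Submodule.ker_liftQ_eq_bot _ _ _ le_rfl))
    ((LinearMap.ker p).liftQ t h)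
  exact ⟨t', LinearMap.ext fun m => LinearMap.congr_fun ht' ((LinearMap.ker p).mkQ m)⟩

lemma bidualMap_surjective {a : D →ₗ[Sᵐᵒᵖ] D'} (ha : Function.Surjective a) :
    Function.Surjective (bidualMap R C I a) :=
  Module.Injective.extension_property R I _ _ (LinearMap.lcomp R C a)
    fun _ _ h => (LinearMap.cancel_right ha).1 h

lemma bidualMap_exact {L M K : ModuleCat.{u} Sᵐᵒᵖ} {f : L →ₗ[Sᵐᵒᵖ] M} {g : M →ₗ[Sᵐᵒᵖ] K}
    (h : IsShortExact f g) : Function.Exact (bidualMap R C I f) (bidualMap R C I g) := by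
  refine fun t => ⟨fun ht => exists_comp_eq_of_ker_le (LinearMap.lcomp R C f) t fun φ hφ => ?_, ?_⟩
  · obtain ⟨ψ, rfl⟩ := (h.comp_eq_zero_iff φ).1 hφ
    exact LinearMap.congr_fun ht ψ
  · rintro ⟨t, rfl⟩
    refine LinearMap.ext fun ψ => ?_
    change t ((ψ ∘ₗ g) ∘ₗ f) = 0
    rw [(h.comp_eq_zero_iff _).2 ⟨ψ, rfl⟩, map_zero]

lemma tensorEvalDual_injective [Module.Finite Sᵐᵒᵖ D] :
    Function.Injective (tensorEvalDual (R := R) (S := S) (C := C) (D := D) (I := I)) := by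
  obtain ⟨n, p, hp⟩ := Module.Finite.exists_fin' Sᵐᵒᵖ D
  refine (injective_iff_map_eq_zero _).2 fun χ hχ => ?_
  have comp_eq_zero : χ.comp (bidualMap R C I p) = 0 := by
    refine (map_eq_zero_iff _ tensorEvalDual_bijective_of_projective.1).1 ?_
    rw [tensorEvalDual_naturality, hχ, LinearMap.comp_zero]
  exact (AddMonoidHom.cancel_right (bidualMap_surjective hp)).1 comp_eq_zero

lemma tensorEvalDual_bijective {D : ModuleCat.{u} Sᵐᵒᵖ} (hD : IsFPInfty D) :
    Function.Bijective (tensorEvalDual (R := R) (S := S) (C := C) (D := D) (I := I)) := by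
  have := hD.finite
  refine ⟨tensorEvalDual_injective, fun g => ?_⟩
  obtain ⟨Q, p, _, _, hp, hK⟩ := hD.exists_ker
  have ker_exact := isShortExact_ker_subtype hp
  have dual_exact := CharDual.isShortExact ker_exact
  have := hK.finite
  obtain ⟨χ, hχ⟩ := tensorEvalDual_bijective_of_projective.2 (CharDual.map p ∘ₗ g)
  have comp_eq_zero : χ.comp (bidualMap R C I (LinearMap.ker p).subtype) = 0 := by
    refine (map_eq_zero_iff _ tensorEvalDual_injective).1 ?_
    refine (tensorEvalDual_naturality (LinearMap.ker p).subtype χ).trans ?_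
    rw [hχ, ← LinearMap.comp_assoc]
    exact LinearMap.ext fun f => dual_exact.2.1.apply_apply_eq_zero (g f)
  obtain ⟨χ', rfl⟩ := ((exact_iff_exact_character_comp _ _).1 (bidualMap_exact ker_exact) χ).1
    comp_eq_zero
  exact ⟨χ', LinearMap.ext fun f => dual_exact.1 (LinearMap.congr_fun hχ f)⟩

lemma extZero_homC_charDual {D : ModuleCat.{u} Sᵐᵒᵖ} (hD : IsFPInfty D)
    (hDC : ∀ i, 1 ≤ i → ExtZero D (ModuleCat.of Sᵐᵒᵖ C) i) {i : ℕ} (hi : 1 ≤ i) :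
    ExtZero (ModuleCat.of S (HomC R S C I)) (ModuleCat.of S (CharDual S D)) i := by
  induction i, hi using Nat.le_induction generalizing D with
  | base =>
    obtain ⟨Q, p, _, _, hp, hK⟩ := hD.exists_ker
    have ker_exact := isShortExact_ker_subtype hp
    have dual_exact := CharDual.isShortExact ker_exact
    have : Module.Injective S (ModuleCat.of S (CharDual S Q)) := CharDual.injective
    have bidualMap_injective : Function.Injective (bidualMap R C I (LinearMap.ker p).subtype) :=
      fun t t' htt' => LinearMap.ext fun φ => by
        obtain ⟨ψ, rfl⟩ := ker_exact.exists_extend (hDC 1 le_rfl) φ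
        exact LinearMap.congr_fun htt' ψ
    refine dual_exact.extZero_one_of_exists_lift (extZero_of_injective le_rfl) fun g => ?_
    obtain ⟨χ, rfl⟩ := (tensorEvalDual_bijective hK).2 g
    obtain ⟨χ', rfl⟩ := exists_character_extend _ bidualMap_injective χ
    exact ⟨tensorEvalDual χ', rfl⟩
  | succ i _ ih =>
    obtain ⟨Q, p, _, _, hp, hK⟩ := hD.exists_ker
    have ker_exact := isShortExact_ker_subtype hp
    have : Module.Injective S (ModuleCat.of S (CharDual S Q)) := CharDual.injective
    have extZero_ker (j) (hj : 1 ≤ j) :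
        ExtZero (ModuleCat.of Sᵐᵒᵖ (LinearMap.ker p)) (ModuleCat.of Sᵐᵒᵖ C) j :=
      ker_exact.extZero_left₁ (extZero_of_projective hj) (hDC _ (by lia))
    exact (CharDual.isShortExact ker_exact).extZero_right₁ (extZero_of_injective (by lia))
      (ih hK extZero_ker)

end Injective

end TensorEvaluation

section Evaluation

variable {R S C : Type u} [Ring R] [Ring S] [AddCommGroup C] [Module R C] [Module Sᵐᵒᵖ C]
  [SMulCommClass R Sᵐᵒᵖ C]

/-- The evaluation map `C ⊗_S Hom_R(C, I) → I`, the counit of the adjunction between tensor product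
and homomorphisms. -/
def evalC (R S C I : Type u) [Ring R] [Ring S] [AddCommGroup C] [Module R C] [Module Sᵐᵒᵖ C]
    [SMulCommClass R Sᵐᵒᵖ C] [AddCommGroup I] [Module R I] :
    BTensor R S C (HomC R S C I) →ₗ[R] I :=
  homAdj.symm LinearMap.id

lemma evalC_comp_map_homAdj {N J : Type u} [AddCommGroup N] [Module S N] [AddCommGroup J]
    [Module R J] (t : BTensor R S C N →ₗ[R] J) :
    evalC R S C J ∘ₗ BTensor.map R S C (homAdj t) = t :=
  BTensor.hom_ext fun _ _ => rfl

section HomothetyDual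

attribute [local instance] SMulCommClass.symm

/-- The isomorphism `Hom_R(Hom_{Sᵒᵖ}(C, C), I) ≃ I`, `t ↦ t id`, that results from
`R ≃ Hom_{Sᵒᵖ}(C, C)`. -/
noncomputable def homothetyDual (h : Function.Bijective (leftMul R S C)) (I : Type u)
    [AddCommGroup I] [Module R I] : ((C →ₗ[Sᵐᵒᵖ] C) →ₗ[R] I) ≃+ I :=
  let E : R ≃ₗ[R] (C →ₗ[Sᵐᵒᵖ] C) :=
    LinearEquiv.ofBijective (LinearMap.toSpanSingleton R (C →ₗ[Sᵐᵒᵖ] C) LinearMap.id) h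
  (E.congrLeft I ℤ).symm.toAddEquiv.trans (LinearMap.ringLmapEquivSelf R ℤ I).toAddEquiv

lemma homothetyDual_apply (h : Function.Bijective (leftMul R S C)) {I : Type u}
    [AddCommGroup I] [Module R I] (t : (C →ₗ[Sᵐᵒᵖ] C) →ₗ[R] I) :
    homothetyDual h I t = t LinearMap.id :=
  congrArg t (one_smul R LinearMap.id)

end HomothetyDual

variable (hC : IsSemidualizing R S C) {I : Type u} [AddCommGroup I] [Module R I]
  [Module.Injective R I]
include hC

/- For `D = C` the tensor evaluation map `C ⊗_S Hom_R(C, I) → Hom_R(Hom_{Sᵒᵖ}(C, C), I) ≃ I` is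
`evalC`. -/
lemma evalC_bijective : Function.Bijective (evalC R S C I) := by
  have := SMulCommClass.symm R Sᵐᵒᵖ C
  let e := homothetyDual hC.homothety_left I
  have charAdj_comp_evalC (ξ : I →+ AddCircle (1 : ℚ)) :
      charAdj (ξ.comp (evalC R S C I).toAddMonoidHom) =
        tensorEvalDual (D := C) (ξ.comp e.toAddMonoidHom) :=
    LinearMap.ext fun f => DFunLike.ext _ _ fun c =>
      congrArg ξ (homothetyDual_apply hC.homothety_left (f.toLin ∘ₗ LinearMap.applyₗ' R c)).symm
  have comp_e_bijective :
      Function.Bijective fun ξ : I →+ AddCircle (1 : ℚ) => ξ.comp e.toAddMonoidHom :=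
    (bijective_iff_bijective_character_comp e.toAddMonoidHom).1 e.bijective
  refine (bijective_iff_bijective_character_comp (evalC R S C I).toAddMonoidHom).2
    ((Function.Bijective.of_comp_iff' charAdj.bijective _).1 ?_)
  rw [show charAdj ∘ _ = _ from funext charAdj_comp_evalC]
  exact (tensorEvalDual_bijective (D := ModuleCat.of Sᵐᵒᵖ C) hC.finite_right.isFPInfty).comp
    comp_e_bijective

lemma inAuslander_homC : InAuslander R S C (ModuleCat.of S (HomC R S C I)) := by
  have := SMulCommClass.symm R Sᵐᵒᵖ C
  let e := LinearEquiv.ofBijective (evalC R S C I) (evalC_bijective hC)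
  have map_e_comp_muC : HomC.map e.toLinearMap ∘ₗ muC R S C (HomC R S C I) = LinearMap.id :=
    homAdj.apply_symm_apply LinearMap.id
  have map_e_injective :
      Function.Injective (HomC.map e.toLinearMap : HomC R S C _ →ₗ[S] HomC R S C I) :=
    HomC.map_injective e.injective
  refine inAuslander_iff.2
    ⟨fun i hi => extZero_homC_charDual hC.finite_right.isFPInfty hC.ext_right hi, fun i hi =>
      extZero_congr_right (X := ModuleCat.of R (BTensor R S C (HomC R S C I)))
        (Y := ModuleCat.of R I) e (extZero_of_injective hi), ?_, fun φ => ?_⟩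
  · exact Function.LeftInverse.injective (g := HomC.map e.toLinearMap)
      (LinearMap.congr_fun map_e_comp_muC)
  · exact ⟨HomC.map e.toLinearMap φ, map_e_injective (LinearMap.congr_fun map_e_comp_muC _)⟩

omit [Module.Injective R I] in
lemma IsCInjective.inAuslander {U : ModuleCat.{u} S} (hU : IsCInjective R S C U) :
    InAuslander R S C U := by
  obtain ⟨I, hI, ⟨e⟩⟩ := hU
  have : Module.Injective R I := Module.injective_module_of_injective_object R I
  exact (inAuslander_homC hC).of_equiv e

end Evaluation

section Closure

variable {R S C : Type u} [Ring R] [Ring S] [AddCommGroup C] [Module R C] [Module Sᵐᵒᵖ C]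
  [SMulCommClass R Sᵐᵒᵖ C]

lemma HomC.map_exact {L M K : ModuleCat.{u} R} {f : L →ₗ[R] M} {g : M →ₗ[R] K}
    (h : IsShortExact f g) : Function.Exact (HomC.map f : HomC R S C L →ₗ[S] HomC R S C M)
      (HomC.map g : HomC R S C M →ₗ[S] HomC R S C K) := by
  refine fun φ => ⟨fun hφ => ?_, ?_⟩
  · have mem_range (c : C) : φ.toLin c ∈ Set.range f := (h.2.1 _).1 (LinearMap.congr_fun hφ c)
    exact ⟨HomC.ofLin (φ.toLin.codLift f h.1 mem_range), LinearMap.comp_codLift _ f h.1 mem_range⟩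
  · rintro ⟨φ, rfl⟩
    exact HomC.ext fun c => h.2.1.apply_apply_eq_zero (φ.toLin c)

lemma HomC.map_surjective {L M K : ModuleCat.{u} R} {f : L →ₗ[R] M} {g : M →ₗ[R] K}
    (h : IsShortExact f g) (hL : ExtZero (ModuleCat.of R C) L 1) :
    Function.Surjective (HomC.map g : HomC R S C M →ₗ[S] HomC R S C K) :=
  fun φ => h.exists_lift hL φ.toLin

namespace IsShortExact

variable {L M K : ModuleCat.{u} S} {f : L →ₗ[S] M} {g : M →ₗ[S] K}

lemma bTensor (h : IsShortExact f g) (hK : ExtZero K (ModuleCat.of S (CharDual S C)) 1) :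
    IsShortExact (L := ModuleCat.of R (BTensor R S C L)) (M := ModuleCat.of R (BTensor R S C M))
      (K := ModuleCat.of R (BTensor R S C K)) (BTensor.map R S C f) (BTensor.map R S C g) :=
  BTensor.isShortExact h ((BTensor.map_injective_iff f).2 (h.exists_extend hK))

lemma inAuslander₁ (h : IsShortExact f g) (hM : InAuslander R S C M) (hK : InAuslander R S C K) :
    InAuslander R S C L := by
  have tensor_exact := h.bTensor (R := R) (hK.extZero_charDual le_rfl)
  have map_surjective : Function.Surjective
      (HomC.map (BTensor.map R S C g) : HomC R S C _ →ₗ[S] HomC R S C _) :=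
    Function.Surjective.of_comp (g := muC R S C M) (hK.mu_bijective.2.comp h.2.2)
  refine inAuslander_iff.2 ⟨fun i hi => h.extZero_left₁ (hM.extZero_charDual hi)
    (hK.extZero_charDual (by lia)), fun i hi => ?_, ?_⟩
  · obtain rfl | hi := hi.eq_or_lt
    · exact tensor_exact.extZero_one_of_exists_lift (hM.ext_vanish 1 le_rfl) map_surjective
    · obtain ⟨i, rfl⟩ := Nat.exists_eq_add_of_le' hi
      exact tensor_exact.extZero_right₁ (hM.ext_vanish _ (by lia)) (hK.ext_vanish _ (by lia))
  · exact AddMonoidHom.bijective_of_bijective_of_injective_of_left_exact f.toAddMonoidHom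
      g.toAddMonoidHom (HomC.map (BTensor.map R S C f)).toAddMonoidHom
      (HomC.map (BTensor.map R S C g)).toAddMonoidHom (muC R S C L).toAddMonoidHom
      (muC R S C M).toAddMonoidHom (muC R S C K).toAddMonoidHom rfl rfl h.2.1
      (HomC.map_exact tensor_exact) hM.mu_bijective hK.mu_bijective.1 h.1
      (HomC.map_injective tensor_exact.1)

lemma inAuslander₂ (h : IsShortExact f g) (hL : InAuslander R S C L) (hK : InAuslander R S C K) :
    InAuslander R S C M := by
  have tensor_exact := h.bTensor (R := R) (hK.extZero_charDual le_rfl)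
  refine inAuslander_iff.2 ⟨fun i hi => h.extZero_left₂ (hL.extZero_charDual hi)
    (hK.extZero_charDual hi), fun i hi => tensor_exact.extZero_right₂ (hL.ext_vanish i hi)
    (hK.ext_vanish i hi), ?_⟩
  exact AddMonoidHom.bijective_of_surjective_of_bijective_of_bijective_of_injective
    (0 : Unit →+ L) f.toAddMonoidHom g.toAddMonoidHom (0 : K →+ Unit)
    (0 : Unit →+ _) (HomC.map (BTensor.map R S C f)).toAddMonoidHom
    (HomC.map (BTensor.map R S C g)).toAddMonoidHom (0 : _ →+ Unit) (AddMonoidHom.id Unit)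
    (muC R S C L).toAddMonoidHom (muC R S C M).toAddMonoidHom (muC R S C K).toAddMonoidHom
    (AddMonoidHom.id Unit) (by simp) rfl rfl rfl ((LinearMap.exact_zero_iff_injective Unit f).2 h.1)
    h.2.1 ((LinearMap.exact_zero_iff_surjective Unit g).2 h.2.2)
    ((LinearMap.exact_zero_iff_injective Unit (HomC.map (BTensor.map R S C f))).2
      (HomC.map_injective tensor_exact.1)) (HomC.map_exact tensor_exact)
    ((LinearMap.exact_zero_iff_surjective Unit (HomC.map (BTensor.map R S C g))).2
      (HomC.map_surjective tensor_exact (hL.ext_vanish 1 le_rfl)))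
    Function.surjective_id hL.mu_bijective hK.mu_bijective Function.injective_id

lemma inAuslander₃ (h : IsShortExact f g) (hL : InAuslander R S C L) (hM : InAuslander R S C M)
    (hK : ExtZero K (ModuleCat.of S (CharDual S C)) 1) : InAuslander R S C K := by
  have tensor_exact := h.bTensor (R := R) hK
  refine inAuslander_iff.2 ⟨fun i hi => ?_, fun i hi => tensor_exact.extZero_right₃
    (hL.ext_vanish _ (by lia)) (hM.ext_vanish i hi), ?_⟩
  · obtain rfl | hi := hi.eq_or_lt
    · exact hK
    · obtain ⟨i, rfl⟩ := Nat.exists_eq_add_of_le' hi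
      exact h.extZero_left₃ (hL.extZero_charDual (by lia)) (hM.extZero_charDual (by lia))
  · exact AddMonoidHom.bijective_of_surjective_of_bijective_of_right_exact f.toAddMonoidHom
      g.toAddMonoidHom (HomC.map (BTensor.map R S C f)).toAddMonoidHom
      (HomC.map (BTensor.map R S C g)).toAddMonoidHom (muC R S C L).toAddMonoidHom
      (muC R S C M).toAddMonoidHom (muC R S C K).toAddMonoidHom rfl rfl h.2.1
      (HomC.map_exact tensor_exact) hL.mu_bijective.2 hM.mu_bijective h.2.2
      (HomC.map_surjective tensor_exact (hL.ext_vanish 1 le_rfl))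

end IsShortExact

lemma exists_surjective_of_projective {A : Type u} [Ring A] (N : ModuleCat.{u} A) :
    ∃ (P : ModuleCat.{u} A) (p : P →ₗ[A] N), Module.Projective A P ∧ Function.Surjective p :=
  ⟨ModuleCat.of A (N →₀ A), Finsupp.linearCombination A id,
    inferInstanceAs (Module.Projective A (N →₀ A)), Finsupp.linearCombination_id_surjective A N⟩

lemma IsCInjective.extZero {Z U : ModuleCat.{u} S} (hU : IsCInjective R S C U)
    (hZ : ExtZero Z (ModuleCat.of S (CharDual S C)) 1) : ExtZero Z U 1 := by
  obtain ⟨I, hI, ⟨e⟩⟩ := hU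
  have : Module.Injective R I := Module.injective_module_of_injective_object R I
  obtain ⟨P, p, hP, hp⟩ := exists_surjective_of_projective Z
  have ker_exact := isShortExact_ker_subtype hp
  refine extZero_congr_right (Y := ModuleCat.of S (HomC R S C I)) e
    (ker_exact.extZero_one_of_exists_extend (extZero_of_projective le_rfl) fun φ => ?_)
  obtain ⟨t, ht⟩ := Module.Injective.extension_property R I _ _
    (BTensor.map R S C (LinearMap.ker p).subtype) (ker_exact.bTensor hZ).1 (homAdj.symm φ)
  exact ⟨homAdj t, homAdj.symm_apply_eq.1 ht.symm |>.symm⟩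

lemma InAuslander.exists_isCInjective_embedding (hC : IsSemidualizing R S C) {N : ModuleCat.{u} S}
    (hN : InAuslander R S C N) :
    ∃ (U N' : ModuleCat.{u} S) (f : N →ₗ[S] U) (g : U →ₗ[S] N'), IsShortExact f g ∧
      IsCInjective R S C U ∧ InAuslander R S C N' := by
  let J := Injective.under (ModuleCat.of R (BTensor R S C N))
  let j : BTensor R S C N →ₗ[R] J := (Injective.ι (ModuleCat.of R (BTensor R S C N))).hom
  have j_injective : Function.Injective j := (ModuleCat.mono_iff_injective _).1 inferInstance
  let f : N →ₗ[S] HomC R S C J := homAdj j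
  have f_injective : Function.Injective f :=
    (HomC.map_injective j_injective).comp hN.mu_bijective.1
  have map_f_injective : Function.Injective (BTensor.map R S C f) := by
    refine Function.Injective.of_comp (f := evalC R S C J) ?_
    rwa [← LinearMap.coe_comp, evalC_comp_map_homAdj]
  have hU : IsCInjective R S C (ModuleCat.of S (HomC R S C J)) :=
    ⟨J, inferInstance, ⟨LinearEquiv.refl S _⟩⟩
  have exact := isShortExact_range_mkQ (M := ModuleCat.of S (HomC R S C J)) f_injective
  refine ⟨_, _, f, _, exact, hU, exact.inAuslander₃ hN (hU.inAuslander hC) ?_⟩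
  exact exact.extZero_one_of_exists_extend ((hU.inAuslander hC).extZero_charDual le_rfl)
    ((BTensor.map_injective_iff f).1 map_f_injective)

end Closure

section ResolutionDimension

variable {A : Type u} [Ring A] {𝒳 ω : ObjectProperty (ModuleCat.{u} A)} {L M K N : ModuleCat.{u} A}

/-- `𝒳-pd N ≤ n`, by recursion on `n`: the resolution is cut into short exact sequences. -/
def ResDimLE (𝒳 : ObjectProperty (ModuleCat.{u} A)) : ℕ → ModuleCat.{u} A → Prop
  | 0, N => 𝒳 N
  | n + 1, N => ∃ (K X : ModuleCat.{u} A) (f : K →ₗ[A] X) (g : X →ₗ[A] N), IsShortExact f g ∧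
      𝒳 X ∧ ResDimLE 𝒳 n K

lemma ResDimLE.mono (h : ω ≤ 𝒳) {n : ℕ} (hN : ResDimLE ω n N) : ResDimLE 𝒳 n N := by
  induction n generalizing N with
  | zero => exact h N hN
  | succ n ih =>
    obtain ⟨K, X, f, g, hfg, hX, hK⟩ := hN
    exact ⟨K, X, f, g, hfg, h X hX, ih hK⟩

namespace IsShortExact

variable {f : L →ₗ[A] M} {g : M →ₗ[A] K}

lemma bijective_of_subsingleton [Subsingleton L] (h : IsShortExact f g) :
    Function.Bijective g := by
  refine ⟨(injective_iff_map_eq_zero g).2 fun m hm => ?_, h.2.2⟩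
  obtain ⟨l, rfl⟩ := (h.2.1 m).1 hm
  rw [Subsingleton.elim l 0, map_zero]

end IsShortExact

lemma isShortExact_zero_id (N : ModuleCat.{u} A) :
    IsShortExact (L := ModuleCat.of A PUnit) (0 : PUnit.{u + 1} →ₗ[A] N) LinearMap.id :=
  ⟨Function.injective_of_subsingleton _, (LinearMap.exact_zero_iff_injective _ _).2 fun _ _ h => h,
    Function.surjective_id⟩

lemma ResDimLE.hasResolutionOfLength {n : ℕ} (h : ResDimLE 𝒳 n N) :
    HasResolutionOfLength 𝒳 N n := by
  induction n generalizing N with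
  | zero =>
    refine ⟨fun i => Nat.casesOn i N fun _ => ModuleCat.of A PUnit, fun _ => 0, LinearMap.id,
      fun i hi => ?_, fun i hi => ?_, Function.surjective_id,
      fun x => ⟨fun hx => ⟨0, hx.symm⟩, fun ⟨_, hy⟩ => hy.symm⟩,
      fun _ _ => ⟨fun _ => ⟨0, Subsingleton.elim (α := PUnit) _ _⟩, fun _ => rfl⟩⟩
    · obtain rfl : i = 0 := Nat.le_zero.1 hi
      exact h
    · obtain ⟨i, rfl⟩ := Nat.exists_eq_add_of_le' hi
      exact inferInstanceAs (Subsingleton PUnit)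
  | succ n ih =>
    obtain ⟨K, Y, f, g, hfg, hY, hK⟩ := h
    obtain ⟨X, d, ε, hX, subsingleton_X, hε, exact_ε, exact_d⟩ := ih hK
    refine ⟨fun i => Nat.casesOn i Y X, fun i => match i with
      | 0 => f ∘ₗ ε
      | i + 1 => d i, g, fun i hi => ?_, fun i hi => ?_, hfg.2.2,
      hε.comp_exact_iff_exact.2 hfg.2.1, fun i => ?_⟩
    · cases i with
      | zero => exact hY
      | succ i => exact hX i (by lia)
    · obtain ⟨i, rfl⟩ := Nat.exists_eq_add_of_le' (Nat.one_le_of_lt hi)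
      exact subsingleton_X i (by lia)
    · cases i with
      | zero => exact exact_ε.comp_injective f hfg.1 (map_zero f)
      | succ i => exact exact_d i

section ClosedUnderIsomorphisms

variable [𝒳.IsClosedUnderIsomorphisms]

lemma IsShortExact.prop_of_subsingleton {f : L →ₗ[A] M} {g : M →ₗ[A] K} [Subsingleton L]
    (h : IsShortExact f g) (hM : 𝒳 M) : 𝒳 K :=
  𝒳.prop_of_iso (LinearEquiv.ofBijective g h.bijective_of_subsingleton).toModuleIso hM

lemma HasResolutionOfLength.resDimLE {n : ℕ} (h : HasResolutionOfLength 𝒳 N n) :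
    ResDimLE 𝒳 n N := by
  induction n generalizing N with
  | zero =>
    obtain ⟨X, d, ε, hX, subsingleton_X, hε, exact_ε, -⟩ := h
    have : Subsingleton (X 1) := subsingleton_X 1 one_pos
    have ε_injective : Function.Injective ε := by
      refine (injective_iff_map_eq_zero ε).2 fun x hx => ?_
      obtain ⟨y, rfl⟩ := (exact_ε x).1 hx
      rw [Subsingleton.elim y 0, map_zero]
    exact 𝒳.prop_of_iso (LinearEquiv.ofBijective ε ⟨ε_injective, hε⟩).toModuleIso (hX 0 le_rfl)
  | succ n ih =>
    obtain ⟨X, d, ε, hX, subsingleton_X, hε, exact_ε, exact_d⟩ := h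
    refine ⟨_, X 0, _, ε, isShortExact_ker_subtype hε, hX 0 (Nat.zero_le _),
      ih ⟨fun i => X (i + 1), fun i => d (i + 1),
        (d 0).codRestrict (LinearMap.ker ε) exact_ε.apply_apply_eq_zero,
        fun i hi => hX _ (by lia), fun i hi => subsingleton_X _ (by lia), ?_, fun x => ?_,
        fun i => exact_d _⟩⟩
    · rintro ⟨y, hy⟩
      obtain ⟨x, rfl⟩ := (exact_ε y).1 hy
      exact ⟨x, rfl⟩
    · rw [← exact_d 0 x]
      exact Subtype.ext_iff

lemma exists_resDimLE_of_relPd_lt_top (h : relPd 𝒳 N < ⊤) : ∃ m, ResDimLE 𝒳 m N := by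
  simp only [relPd, iInf_lt_iff] at h
  obtain ⟨m, hm, -⟩ := h
  exact ⟨m, hm.resDimLE⟩

variable [𝒳.ContainsZero]

lemma ResDimLE.succ {n : ℕ} (hN : ResDimLE 𝒳 n N) : ResDimLE 𝒳 (n + 1) N := by
  induction n generalizing N with
  | zero => exact ⟨_, N, _, _, isShortExact_zero_id N, hN,
      𝒳.prop_of_isZero (ModuleCat.isZero_of_subsingleton _)⟩
  | succ n ih =>
    obtain ⟨K, X, f, g, hfg, hX, hK⟩ := hN
    exact ⟨K, X, f, g, hfg, hX, ih hK⟩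

lemma ResDimLE.of_le {m n : ℕ} (hN : ResDimLE 𝒳 m N) (hmn : m ≤ n) : ResDimLE 𝒳 n N := by
  induction n, hmn using Nat.le_induction with
  | base => exact hN
  | succ n _ ih => exact ih.succ

lemma relPd_le_iff {n : ℕ} : relPd 𝒳 N ≤ n ↔ ResDimLE 𝒳 n N := by
  refine ⟨fun h => ?_, fun h => iInf₂_le n h.hasResolutionOfLength⟩
  have relPd_lt : relPd 𝒳 N < (n + 1 : ℕ) := h.trans_lt (Nat.cast_lt.2 n.lt_succ_self)
  simp only [relPd, iInf_lt_iff] at relPd_lt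
  obtain ⟨m, hm, m_lt⟩ := relPd_lt
  exact hm.resDimLE.of_le (Nat.le_of_lt_succ (Nat.cast_lt.1 m_lt))

lemma relPd_add_one_le_iff {n : ℕ} : relPd 𝒳 N + 1 ≤ n ↔ ∃ m, n = m + 1 ∧ ResDimLE 𝒳 m N := by
  cases n with
  | zero => simp
  | succ n =>
    rw [Nat.cast_succ, ENat.add_le_add_iff_right ENat.one_ne_top, relPd_le_iff]
    exact ⟨fun h => ⟨n, rfl, h⟩, fun ⟨_, hm, h⟩ => Nat.succ_injective hm ▸ h⟩

end ClosedUnderIsomorphisms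

end ResolutionDimension

section Syzygy

variable {A : Type u} [Ring A] {𝒳 : ObjectProperty (ModuleCat.{u} A)}
  {L M K N Y : ModuleCat.{u} A}

/-- A class of modules is resolving if it contains the projective modules and is closed under
isomorphisms, extensions and kernels of surjections. -/
class IsResolving (𝒳 : ObjectProperty (ModuleCat.{u} A)) : Prop
    extends 𝒳.IsClosedUnderIsomorphisms where
  prop_of_projective (P : ModuleCat.{u} A) [Module.Projective A P] : 𝒳 P
  prop₁ {L M K : ModuleCat.{u} A} {f : L →ₗ[A] M} {g : M →ₗ[A] K} :
    IsShortExact f g → 𝒳 M → 𝒳 K → 𝒳 L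
  prop₂ {L M K : ModuleCat.{u} A} {f : L →ₗ[A] M} {g : M →ₗ[A] K} :
    IsShortExact f g → 𝒳 L → 𝒳 K → 𝒳 M

instance [IsResolving 𝒳] : 𝒳.ContainsZero where
  exists_zero := ⟨ModuleCat.of A PUnit, ModuleCat.isZero_of_subsingleton _,
    IsResolving.prop_of_projective _⟩

/-- A module `Y` such that `Ext^i(-, Y)`, `i ≥ 1`, vanishes on the class `𝒳` and detects which
cokernels of injections between modules of `𝒳` are again in `𝒳`. For the Auslander class this is
the character module of `C`. -/
structure IsTestModule (𝒳 : ObjectProperty (ModuleCat.{u} A)) (Y : ModuleCat.{u} A) : Prop where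
  extZero {X : ModuleCat.{u} A} {i : ℕ} : 𝒳 X → 1 ≤ i → ExtZero X Y i
  prop₃ {L M K : ModuleCat.{u} A} {f : L →ₗ[A] M} {g : M →ₗ[A] K} :
    IsShortExact f g → 𝒳 L → 𝒳 M → ExtZero K Y 1 → 𝒳 K

lemma ResDimLE.extZero (hY : IsTestModule 𝒳 Y) {n : ℕ} (hN : ResDimLE 𝒳 n N) {i : ℕ}
    (hi : n + 1 ≤ i) : ExtZero N Y i := by
  induction n generalizing N i with
  | zero => exact hY.extZero hN hi
  | succ n ih =>
    obtain ⟨K, X, f, g, hfg, hX, hK⟩ := hN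
    obtain ⟨i, rfl⟩ := Nat.exists_eq_add_of_le' (show 1 ≤ i by lia)
    exact hfg.extZero_left₃ (ih hK (by lia)) (hY.extZero hX (by lia))

lemma ResDimLE.prop_of_extZero (hY : IsTestModule 𝒳 Y) {m : ℕ} (hN : ResDimLE 𝒳 m N)
    (h : ∀ i, 1 ≤ i → ExtZero N Y i) : 𝒳 N := by
  induction m generalizing N with
  | zero => exact hN
  | succ m ih =>
    obtain ⟨K, X, f, g, hfg, hX, hK⟩ := hN
    exact hY.prop₃ hfg (ih hK fun i hi => hfg.extZero_left₁ (hY.extZero hX hi) (h _ (by lia))) hX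
      (h 1 le_rfl)

lemma ResDimLE.of_extZero [𝒳.IsClosedUnderIsomorphisms] [𝒳.ContainsZero] (hY : IsTestModule 𝒳 Y)
    {m n : ℕ} (hN : ResDimLE 𝒳 m N) (h : ∀ i, n + 1 ≤ i → ExtZero N Y i) : ResDimLE 𝒳 n N := by
  induction n generalizing m N with
  | zero => exact hN.prop_of_extZero hY h
  | succ n ih =>
    cases m with
    | zero => exact hN.of_le (Nat.zero_le _)
    | succ m =>
      obtain ⟨K, X, f, g, hfg, hX, hK⟩ := hN
      exact ⟨K, X, f, g, hfg, hX, ih hK fun i hi =>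
        hfg.extZero_left₁ (hY.extZero hX (by lia)) (h _ (by lia))⟩

lemma exists_isSyzygy (n : ℕ) (N : ModuleCat.{u} A) : ∃ K, IsSyzygy n N K := by
  induction n generalizing N with
  | zero => exact ⟨N, ⟨LinearEquiv.refl A N⟩⟩
  | succ n ih =>
    obtain ⟨P, p, hP, hp⟩ := exists_surjective_of_projective N
    obtain ⟨K, hK⟩ := ih (ModuleCat.of A (LinearMap.ker p))
    exact ⟨K, P, p, hP, hp, hK⟩

lemma surjective_coprod_of_exact {X P : ModuleCat.{u} A} {f : M →ₗ[A] X} {q : X →ₗ[A] N}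
    (hfq : Function.Exact f q) {φ : P →ₗ[A] X} (hφ : Function.Surjective (q ∘ₗ φ)) :
    Function.Surjective (f.coprod φ) := by
  intro x
  obtain ⟨y, hy⟩ := hφ (q x)
  have q_sub : q (x - φ y) = 0 := by rw [map_sub, ← hy, LinearMap.comp_apply, sub_self]
  obtain ⟨m, hm⟩ := (hfq _).1 q_sub
  exact ⟨(m, y), by rw [LinearMap.coprod_apply, hm, sub_add_cancel]⟩

/-- The map `ker (f, φ) → ker (q φ)`, `(m, y) ↦ y`, where `(f, φ) : M × P → X` and `q f = 0`. -/
def kerCoprodSnd {X P : ModuleCat.{u} A} {f : M →ₗ[A] X} {q : X →ₗ[A] N}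
    (hfq : Function.Exact f q) (φ : P →ₗ[A] X) :
    LinearMap.ker (f.coprod φ) →ₗ[A] LinearMap.ker (q ∘ₗ φ) :=
  (LinearMap.snd A M P).restrict fun z hz => by
    have q_apply : q (f z.1 + φ z.2) = q 0 := congrArg q hz
    rwa [map_add, hfq.apply_apply_eq_zero, zero_add, map_zero] at q_apply

lemma exists_isShortExact_ker_coprod {X P : ModuleCat.{u} A} {e : L →ₗ[A] M} {f : M →ₗ[A] X}
    {q : X →ₗ[A] N} (he : Function.Injective e) (hef : Function.Exact e f)
    (hfq : Function.Exact f q) (φ : P →ₗ[A] X) :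
    ∃ i : L →ₗ[A] LinearMap.ker (f.coprod φ),
      IsShortExact (M := ModuleCat.of A (LinearMap.ker (f.coprod φ)))
        (K := ModuleCat.of A (LinearMap.ker (q ∘ₗ φ))) i (kerCoprodSnd hfq φ) := by
  refine ⟨(LinearMap.inl A M P ∘ₗ e).codRestrict _ fun l => ?_, fun l l' hl => ?_,
    fun z => ⟨fun hz => ?_, ?_⟩, fun y => ?_⟩
  · simp [hef.apply_apply_eq_zero]
  · exact he (congrArg (fun z => z.1.1) hl)
  · have snd_eq_zero : z.1.2 = 0 := congrArg Subtype.val hz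
    have f_fst : f z.1.1 = 0 := by
      have := z.2
      rwa [LinearMap.mem_ker, LinearMap.coprod_apply, snd_eq_zero, map_zero, add_zero] at this
    obtain ⟨l, hl⟩ := (hef _).1 f_fst
    exact ⟨l, Subtype.ext (Prod.ext hl snd_eq_zero.symm)⟩
  · rintro ⟨l, rfl⟩
    rfl
  · obtain ⟨m, hm⟩ := (hfq (φ y)).1 y.2
    exact ⟨⟨(-m, y), by simp [hm]⟩, rfl⟩

lemma ResDimLE.ker_of_projective [IsResolving 𝒳] {n : ℕ} (hN : ResDimLE 𝒳 (n + 1) N)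
    {P : ModuleCat.{u} A} [Module.Projective A P] {p : P →ₗ[A] N} (hp : Function.Surjective p) :
    ResDimLE 𝒳 n (ModuleCat.of A (LinearMap.ker p)) := by
  obtain ⟨K, X, f, q, hfq, hX, hK⟩ := hN
  obtain ⟨φ, rfl⟩ := Module.projective_lifting_property q p hfq.2.2
  have ker_coprod {M : ModuleCat.{u} A} (hM : 𝒳 M) {f : M →ₗ[A] X} (hfq : Function.Exact f q) :
      𝒳 (ModuleCat.of A (LinearMap.ker (f.coprod φ))) := by
    have prop_prod : 𝒳 (ModuleCat.of A (M × P)) := IsResolving.prop₂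
      (f := LinearMap.inl A M P) (g := LinearMap.snd A M P)
      ⟨LinearMap.inl_injective, Function.Exact.inl_snd, Prod.snd_surjective⟩ hM
      (IsResolving.prop_of_projective P)
    exact IsResolving.prop₁ (M := ModuleCat.of A (M × P))
      (isShortExact_ker_subtype (surjective_coprod_of_exact hfq hp)) prop_prod hX
  cases n with
  | zero =>
    obtain ⟨i, hi⟩ := exists_isShortExact_ker_coprod (L := ModuleCat.of A PUnit)
      (Function.injective_of_subsingleton (0 : PUnit.{u + 1} →ₗ[A] K))
      ((LinearMap.exact_zero_iff_injective _ f).2 hfq.1) hfq.2.1 φ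
    have : Subsingleton (ModuleCat.of A PUnit.{u + 1}) := inferInstanceAs (Subsingleton PUnit)
    exact hi.prop_of_subsingleton (𝒳 := 𝒳) (ker_coprod hK hfq.2.1)
  | succ n =>
    obtain ⟨K', X', f', g', hfg', hX', hK'⟩ := hK
    have exact_comp : Function.Exact (f ∘ₗ g') q := hfg'.2.2.comp_exact_iff_exact.2 hfq.2.1
    obtain ⟨i, hi⟩ := exists_isShortExact_ker_coprod hfg'.1
      (hfg'.2.1.comp_injective f hfq.1 (map_zero f)) exact_comp φ
    exact ⟨K', _, i, _, hi, ker_coprod hX' exact_comp, hK'⟩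

namespace IsSyzygy

variable [IsResolving 𝒳] {n : ℕ}

lemma prop_of_resDimLE (hK : IsSyzygy n N K) (hN : ResDimLE 𝒳 n N) : 𝒳 K := by
  induction n generalizing N with
  | zero =>
    obtain ⟨e⟩ := hK
    exact 𝒳.prop_of_iso e.symm.toModuleIso hN
  | succ n ih =>
    obtain ⟨P, p, hP, hp, hK⟩ := hK
    exact ih hK (hN.ker_of_projective hp)

lemma resDimLE (hK : IsSyzygy n N K) (h : 𝒳 K) : ResDimLE 𝒳 n N := by
  induction n generalizing N with
  | zero =>
    obtain ⟨e⟩ := hK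
    exact 𝒳.prop_of_iso e.toModuleIso h
  | succ n ih =>
    obtain ⟨P, p, hP, hp, hK⟩ := hK
    exact ⟨_, P, _, p, isShortExact_ker_subtype hp, IsResolving.prop_of_projective P, ih hK⟩

end IsSyzygy

end Syzygy

section Approximation

variable {A : Type u} [Ring A] {𝒳 ω : ObjectProperty (ModuleCat.{u} A)}
  {L M K N X H E : ModuleCat.{u} A}

section Pushout

/- A pushout square with sides `i : K → X`, `a : K → H`, `i' : H → E`, `a' : X → E` is encoded as an
exact sequence `K → X × H → E → 0` with maps `(i, -a)` and `(a', i')`. -/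

lemma exists_pushout (i : K →ₗ[A] X) (a : K →ₗ[A] H) :
    ∃ (E : ModuleCat.{u} A) (a' : X →ₗ[A] E) (i' : H →ₗ[A] E),
      Function.Exact (i.prod (-a)) (a'.coprod i') ∧ Function.Surjective (a'.coprod i') := by
  let π := (LinearMap.range (i.prod (-a))).mkQ
  have coprod_eq : (π ∘ₗ LinearMap.inl A X H).coprod (π ∘ₗ LinearMap.inr A X H) = π := by
    rw [← LinearMap.comp_coprod, LinearMap.coprod_inl_inr, LinearMap.comp_id]
  refine ⟨ModuleCat.of A ((X × H) ⧸ LinearMap.range (i.prod (-a))), π ∘ₗ LinearMap.inl A X H,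
    π ∘ₗ LinearMap.inr A X H, ?_⟩
  rw [coprod_eq]
  exact ⟨LinearMap.exact_map_mkQ_range _, Submodule.mkQ_surjective _⟩

variable {i : K →ₗ[A] X} {a : K →ₗ[A] H} {a' : X →ₗ[A] E} {i' : H →ₗ[A] E}

lemma exact_pushout_swap (hE : Function.Exact (i.prod (-a)) (a'.coprod i')) :
    Function.Exact (a.prod (-i)) (i'.coprod a') := by
  rintro ⟨y, x⟩
  rw [LinearMap.coprod_apply, add_comm]
  refine (hE (x, y)).trans ⟨?_, ?_⟩
  · rintro ⟨k, hk⟩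
    exact ⟨-k, by simpa [Prod.ext_iff, and_comm] using hk⟩
  · rintro ⟨k, hk⟩
    exact ⟨-k, by simpa [Prod.ext_iff, and_comm] using hk⟩

lemma surjective_pushout_swap (hE : Function.Surjective (a'.coprod i')) :
    Function.Surjective (i'.coprod a') := by
  intro e
  obtain ⟨⟨x, y⟩, hxy⟩ := hE e
  exact ⟨(y, x), (add_comm _ _).trans hxy⟩

lemma IsShortExact.pushout {p : X →ₗ[A] N} (h : IsShortExact i p)
    (hE : Function.Exact (i.prod (-a)) (a'.coprod i')) (hE' : Function.Surjective (a'.coprod i')) :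
    ∃ p' : E →ₗ[A] N, IsShortExact i' p' := by
  have prod_exact : IsShortExact (M := ModuleCat.of A (X × H)) (i.prod (-a)) (a'.coprod i') :=
    ⟨fun _ _ hk => h.1 (congrArg Prod.fst hk), hE, hE'⟩
  obtain ⟨p', hp'⟩ := (prod_exact.comp_eq_zero_iff (p ∘ₗ LinearMap.fst A X H)).1
    (LinearMap.ext h.2.1.apply_apply_eq_zero)
  have p'_apply (x : X) (y : H) : p' (a' x + i' y) = p x := LinearMap.congr_fun hp' (x, y)
  have comm (k : K) : a' (i k) = i' (a k) := by
    simpa [← sub_eq_add_neg, sub_eq_zero] using hE.apply_apply_eq_zero k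
  refine ⟨p', (injective_iff_map_eq_zero i').2 fun y hy => ?_, fun e => ⟨fun he => ?_, ?_⟩,
    fun n => ?_⟩
  · obtain ⟨k, hk⟩ := (hE (0, y)).1 (by simp [hy])
    obtain rfl : k = 0 := h.1 ((congrArg Prod.fst hk).trans (map_zero i).symm)
    simpa using (congrArg Prod.snd hk).symm
  · obtain ⟨⟨x, y⟩, rfl⟩ := hE' e
    obtain ⟨k, rfl⟩ := (h.2.1 x).1 ((p'_apply x y).symm.trans he)
    exact ⟨a k + y, by rw [map_add, ← comm, LinearMap.coprod_apply]⟩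
  · rintro ⟨y, rfl⟩
    simpa using p'_apply 0 y
  · obtain ⟨x, rfl⟩ := h.2.2 n
    exact ⟨a' x, by simpa using p'_apply x 0⟩

lemma IsShortExact.pushout_comp {f : L →ₗ[A] K} (h : IsShortExact f a)
    (hi : Function.Injective i) (hE : Function.Exact (i.prod (-a)) (a'.coprod i'))
    (hE' : Function.Surjective (a'.coprod i')) : IsShortExact (i ∘ₗ f) a' := by
  have comm (k : K) : a' (i k) = i' (a k) := by
    simpa [← sub_eq_add_neg, sub_eq_zero] using hE.apply_apply_eq_zero k
  refine ⟨hi.comp h.1, fun x => ⟨fun hx => ?_, ?_⟩, fun e => ?_⟩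
  · obtain ⟨k, hk⟩ := (hE (x, 0)).1 (by simp [hx])
    obtain ⟨l, rfl⟩ := (h.2.1 k).1 (neg_eq_zero.1 (congrArg Prod.snd hk))
    exact ⟨l, congrArg Prod.fst hk⟩
  · rintro ⟨l, rfl⟩
    rw [LinearMap.comp_apply, comm, h.2.1.apply_apply_eq_zero, map_zero]
  · obtain ⟨⟨x, y⟩, rfl⟩ := hE' e
    obtain ⟨k, rfl⟩ := h.2.2 y
    exact ⟨x + i k, by rw [map_add, comm, LinearMap.coprod_apply]⟩

end Pushout

lemma IsShortExact.exists_cover_of_hull [IsResolving 𝒳] {n : ℕ} {i : K →ₗ[A] X} {p : X →ₗ[A] N}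
    (hip : IsShortExact i p) (hX : 𝒳 X)
    (hK : ∃ (H B : ModuleCat.{u} A) (a : K →ₗ[A] H) (b : H →ₗ[A] B), IsShortExact a b ∧ 𝒳 B ∧
      ResDimLE ω n H) :
    ∃ (H E : ModuleCat.{u} A) (f : H →ₗ[A] E) (g : E →ₗ[A] N), IsShortExact f g ∧ 𝒳 E ∧
      ResDimLE ω n H := by
  obtain ⟨H, B, a, b, hab, hB, hH⟩ := hK
  obtain ⟨E, a', i', exact_E, surjective_E⟩ := exists_pushout i a
  obtain ⟨p', hp'⟩ := hip.pushout exact_E surjective_E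
  obtain ⟨b', hb'⟩ :=
    hab.pushout (exact_pushout_swap exact_E) (surjective_pushout_swap surjective_E)
  exact ⟨H, E, i', p', hp', IsResolving.prop₂ hb' hX hB, hH⟩

/-- A subclass `ω` of `𝒳` into which every module of `𝒳` embeds with cokernel in `𝒳`, and whose
members are injective relative to `𝒳`. -/
structure IsInjectiveCogenerator (ω 𝒳 : ObjectProperty (ModuleCat.{u} A)) : Prop where
  le : ω ≤ 𝒳
  exists_embedding {X : ModuleCat.{u} A} : 𝒳 X →
    ∃ (U X' : ModuleCat.{u} A) (f : X →ₗ[A] U) (g : U →ₗ[A] X'), IsShortExact f g ∧ ω U ∧ 𝒳 X'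
  extZero {X U : ModuleCat.{u} A} : 𝒳 X → ω U → ExtZero X U 1

namespace IsInjectiveCogenerator

variable (hω : IsInjectiveCogenerator ω 𝒳)
include hω

lemma exists_hull_of_cover {n : ℕ} {f : H →ₗ[A] X} {g : X →ₗ[A] N} (hfg : IsShortExact f g)
    (hX : 𝒳 X) (hH : ResDimLE ω n H) :
    ∃ (H' X' : ModuleCat.{u} A) (f : N →ₗ[A] H') (g : H' →ₗ[A] X'), IsShortExact f g ∧ 𝒳 X' ∧
      ResDimLE ω (n + 1) H' := by
  obtain ⟨U, X', u, v, huv, hU, hX'⟩ := hω.exists_embedding hX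
  obtain ⟨H', g', u', exact_E, surjective_E⟩ := exists_pushout u g
  obtain ⟨v', hv'⟩ := huv.pushout exact_E surjective_E
  exact ⟨H', X', u', v', hv', hX', H, U, _, _,
    hfg.pushout_comp huv.1 exact_E surjective_E, hU, hH⟩

lemma exists_hull [IsResolving 𝒳] {n : ℕ} (hN : ResDimLE 𝒳 n N) :
    ∃ (H X : ModuleCat.{u} A) (f : N →ₗ[A] H) (g : H →ₗ[A] X), IsShortExact f g ∧ 𝒳 X ∧
      ResDimLE ω n H := by
  induction n generalizing N with
  | zero =>
    obtain ⟨U, X, f, g, hfg, hU, hX⟩ := hω.exists_embedding hN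
    exact ⟨U, X, f, g, hfg, hX, hU⟩
  | succ n ih =>
    obtain ⟨K, X, i, p, hip, hX, hK⟩ := hN
    obtain ⟨H, E, f, g, hfg, hE, hH⟩ := hip.exists_cover_of_hull hX (ih hK)
    exact hω.exists_hull_of_cover hfg hE hH

lemma resDimLE_iff_exists_cover [IsResolving 𝒳] {n : ℕ} :
    ResDimLE 𝒳 n N ↔ ∃ (H X : ModuleCat.{u} A) (f : H →ₗ[A] X) (g : X →ₗ[A] N),
      IsShortExact f g ∧ 𝒳 X ∧ (n = 0 ∧ Subsingleton H ∨ ∃ m, n = m + 1 ∧ ResDimLE ω m H) := by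
  refine ⟨fun hN => ?_, ?_⟩
  · cases n with
    | zero =>
      exact ⟨_, N, _, _, isShortExact_zero_id N, hN,
        .inl ⟨rfl, inferInstanceAs (Subsingleton PUnit)⟩⟩
    | succ n =>
      obtain ⟨K, X, i, p, hip, hX, hK⟩ := hN
      obtain ⟨H, E, f, g, hfg, hE, hH⟩ := hip.exists_cover_of_hull hX (hω.exists_hull hK)
      exact ⟨H, E, f, g, hfg, hE, .inr ⟨n, rfl, hH⟩⟩
  · rintro ⟨H, X, f, g, hfg, hX, ⟨rfl, hH⟩ | ⟨m, rfl, hH⟩⟩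
    · exact hfg.prop_of_subsingleton (𝒳 := 𝒳) hX
    · exact ⟨H, X, f, g, hfg, hX, hH.mono hω.le⟩

lemma isHomExact {f : N →ₗ[A] H} {g : H →ₗ[A] X} (hfg : IsShortExact f g) (hX : 𝒳 X) :
    IsHomExact ω f g :=
  fun _ hU => ⟨fun _ _ hφ => (LinearMap.cancel_right hfg.2.2).1 hφ, hfg.comp_eq_zero_iff,
    hfg.exists_extend (hω.extZero hX hU)⟩

end IsInjectiveCogenerator

end Approximation

section AuslanderClass

variable {R S C : Type u} [Ring R] [Ring S] [AddCommGroup C] [Module R C] [Module Sᵐᵒᵖ C]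
  [SMulCommClass R Sᵐᵒᵖ C]

lemma isResolving_inAuslander (hC : IsSemidualizing R S C) : IsResolving (InAuslander R S C) where
  of_iso e h := h.of_equiv e.symm.toLinearEquiv
  prop_of_projective P _ := inAuslander_of_projective hC P
  prop₁ h := h.inAuslander₁
  prop₂ h := h.inAuslander₂

lemma isTestModule_charDual :
    IsTestModule (InAuslander R S C) (ModuleCat.of S (CharDual S C)) where
  extZero h := h.extZero_charDual
  prop₃ h := h.inAuslander₃

lemma isInjectiveCogenerator_isCInjective (hC : IsSemidualizing R S C) :
    IsInjectiveCogenerator (IsCInjective R S C) (InAuslander R S C) where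
  le _ hU := hU.inAuslander hC
  exists_embedding hX := hX.exists_isCInjective_embedding hC
  extZero hX hU := hU.extZero (hX.extZero_charDual le_rfl)

instance : ObjectProperty.IsClosedUnderIsomorphisms (IsCInjective R S C) where
  of_iso := fun e ⟨I, hI, ⟨e'⟩⟩ => ⟨I, hI, ⟨e.symm.toLinearEquiv.trans e'⟩⟩

instance : ObjectProperty.ContainsZero (IsCInjective R S C) where
  exists_zero := by
    have hI : Limits.IsZero (ModuleCat.of R PUnit.{u + 1}) := ModuleCat.isZero_of_subsingleton _
    have : Subsingleton (HomC R S C PUnit.{u + 1}) :=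
      ⟨fun f g => HomC.ext fun c => Subsingleton.elim (f.toLin c) (g.toLin c)⟩
    exact ⟨ModuleCat.of S (HomC R S C PUnit), ModuleCat.isZero_of_subsingleton _,
      ModuleCat.of R PUnit, hI.injective, ⟨LinearEquiv.refl S _⟩⟩

end AuslanderClass

end AuslanderClass

theorem theorem4p4 (R S C : Type u) [Ring R] [Ring S] [AddCommGroup C] [Module R C]
    [Module Sᵐᵒᵖ C] [SMulCommClass R Sᵐᵒᵖ C] (hC : IsSemidualizing R S C)
    (N : ModuleCat.{u} S) (hN : relPd (InAuslander R S C) N < ⊤) (n : ℕ) :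
    List.TFAE [
      -- the Auslander projective dimension is at most `n`
      relPd (InAuslander R S C) N ≤ n,
      -- some `n`-th syzygy, respectively every `n`-th syzygy, is in the Auslander class
      ∃ K : ModuleCat.{u} S, IsSyzygy n N K ∧ InAuslander R S C K,
      ∀ K : ModuleCat.{u} S, IsSyzygy n N K → InAuslander R S C K,
      -- `Tor` vanishes in degrees at least `n + 1`
      ∀ i : ℕ, n + 1 ≤ i → Subsingleton (TorC R S C i N),
      -- `0 → H → A → N → 0` with the dimension of `H` at most `n - 1`, where dimension
      -- at most `-1` means that `H = 0`
      ∃ (H A : ModuleCat.{u} S) (f : H →ₗ[S] A) (g : A →ₗ[S] N), IsShortExact f g ∧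
        InAuslander R S C A ∧
        ((n = 0 ∧ Subsingleton H) ∨ relPd (IsCInjective R S C) H + 1 ≤ n),
      -- `0 → N → H' → A' → 0` exact
      ∃ (H' A' : ModuleCat.{u} S) (f : N →ₗ[S] H') (g : H' →ₗ[S] A'), IsShortExact f g ∧
        InAuslander R S C A' ∧ relPd (IsCInjective R S C) H' ≤ n,
      -- the same, with a sequence that is moreover exact under `Hom(-, C-injective)`
      ∃ (H' A' : ModuleCat.{u} S) (f : N →ₗ[S] H') (g : H' →ₗ[S] A'), IsShortExact f g ∧
        IsHomExact (IsCInjective R S C) f g ∧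
        InAuslander R S C A' ∧ relPd (IsCInjective R S C) H' ≤ n] := by
  have := isResolving_inAuslander hC
  have hT := isTestModule_charDual (R := R) (S := S) (C := C)
  have hI := isInjectiveCogenerator_isCInjective hC
  obtain ⟨m, hm⟩ := exists_resDimLE_of_relPd_lt_top hN
  simp only [relPd_le_iff, relPd_add_one_le_iff]
  tfae_have 1 → 3 := fun h K hK => hK.prop_of_resDimLE h
  tfae_have 3 → 2 := fun h =>
    let ⟨K, hK⟩ := exists_isSyzygy n N
    ⟨K, hK, h K hK⟩
  tfae_have 2 → 1 := fun ⟨K, hK, h⟩ => hK.resDimLE h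
  tfae_have 1 → 4 := fun h i hi =>
    (subsingleton_torC_iff_extZero_charDual (by lia)).2 (h.extZero hT hi)
  tfae_have 4 → 1 := fun h => hm.of_extZero hT fun i hi =>
    (subsingleton_torC_iff_extZero_charDual (by lia)).1 (h i hi)
  tfae_have 1 ↔ 5 := hI.resDimLE_iff_exists_cover
  tfae_have 1 → 7 := fun h =>
    let ⟨H, X, f, g, hfg, hX, hH⟩ := hI.exists_hull h
    ⟨H, X, f, g, hfg, hI.isHomExact hfg hX, hX, hH⟩
  tfae_have 7 → 6 := fun ⟨H, X, f, g, hfg, _, h⟩ => ⟨H, X, f, g, hfg, h⟩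
  tfae_have 6 → 1 := fun ⟨H, X, f, g, hfg, hX, hH⟩ => hm.of_extZero hT fun i hi =>
    hfg.extZero_left₁ ((hH.mono hI.le).extZero hT hi) (hT.extZero hX (by lia))
  tfae_finish
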